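/- Conventions. An Artin algebra is an algebra over a commutative artinian ring $k$ that is finitely generated as a $k$-module. For an Artin algebra $R$, let $\mathrm{mod}\text{-}R$ be the category of finitely generated right $R$-modules and $\mathrm{gl.dim}\,R=\sup\{\mathrm{pd}\,X_R\mid X\in\mathrm{mod}\text{-}R\}$. For $m,n\ge 0$, $R$ is an $(m,n)$-Igusa–Todorov algebra if there is $U\in\mathrm{mod}\text{-}R$ such that for every $n$-syzygy $K$ of a module in $\mathrm{mod}\text{-}R$ there is an exact sequence $0\to U_m\to\cdots\to U_1\to U_0\to K\to 0$ with all $U_i\in\mathrm{add}(U)$. Put $\mathrm{IT}(R)=\inf\{m\mid R\text{ is an }(m,n)\text{-Igusa–Todorov algebra for some }n\ge0\}$. For rings $A,B$ and bimodules ${}_AN_B$, ${}_BM_A$, let $\Lambda=\begin{pmatrix}A&N\\M&B\end{pmatrix}$ be the Morita context ring with zero bimodule maps, i.e. with multiplication $$\begin{pmatrix}a&n\\m&b\end{pmatrix}\begin{pmatrix}a'&n'\\m'&b'\end{pmatrix}=\begin{pmatrix}aa'&an'+nb'\\ma'+bm'&bb'\end{pmatrix}.$$ For a right $B$-module $Y$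 let $(0,Y,0,0)$ be the right $\Lambda$-module $Y$ on which $\begin{pmatrix}a&n\\m&b\end{pmatrix}$ acts by $y\mapsto yb$. We say that $Y$ has a $B$-tight projective $\Lambda$-resolution if $(0,Y,0,0)$ has a resolution by finitely generated projective right $\Lambda$-modules each of which is isomorphic to $(0,Q,0,0)$ for some right $B$-module $Q$. An $A$-bimodule $N$ is nilpotent if $N^{\otimes n}=0$ for some $n$ (tensor powers over $A$), and right perfect if $\mathrm{pd}\,N_A<\infty$ and $\mathrm{Tor}^A_i(N^{\otimes j},N)=0$ for all $i,j\ge1$. Theorem. (1) Let $\Lambda=\begin{pmatrix}A&N\\M&B\end{pmatrix}$ be a Morita context ring with zero bimodule maps which is an Artin algebra. Assume that $M$ is projective as a left $B$-module and $\mathrm{gl.dim}\,A<\infty$. If the right $B$-module $N$ has a $B$-tight projective $\Lambda$-resolution and $\mathrm{pd}\,N_B<\infty$, then $$\mathrm{IT}(B)\le\mathrm{IT}(\Lambda)\le\mathrm{IT}(B)+2.$$ (2) Let $N$ be an $A$-bimodule such that the Morita context ring $\Lambda=\begin{pmatrix}A&N\\N&A\end{pmatrix}$ with zero bimodule maps is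 an Artin algebra. Assume that $N$ is projective as a left $A$-module and $\mathrm{gl.dim}\,A<\infty$. If $N$ is nilpotent and right perfect, then $$\mathrm{IT}(A)\le\mathrm{IT}(\Lambda)\le\mathrm{IT}(A)+2.$$ -/

import Mathlib

open CategoryTheory TensorProduct

universe u

/-- A ring `R` is an Artin algebra if it is an algebra over some commutative artinian ring `k`
and is finitely generated as a `k`-module. -/
def IsArtinAlgebra (R : Type u) [Ring R] : Prop :=
  ∃ (k : Type u) (_ : CommRing k) (_ : Algebra k R), IsArtinianRing k ∧ Module.Finite k R

/-! ### Igusa-Todorov distance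

Right `R`-modules are modules over `Rᵐᵒᵖ`. The first definitions are for left modules over a ring
`S`; they are applied to `S = Rᵐᵒᵖ`. -/

/-- `K` is an `n`-syzygy of `X`: there is an exact sequence
`0 → K → P_{n-1} → ⋯ → P_0 → X → 0` with finitely generated projective `P_i`
(and `K ≅ X` if `n = 0`). -/
def IsSyzygy (S : Type u) [Ring S] : ℕ → ModuleCat.{u} S → ModuleCat.{u} S → Prop
  | 0, X, K => Nonempty (K ≃ₗ[S] X)
  | n + 1, X, K => ∃ (P L : ModuleCat.{u} S) (f : L →ₗ[S] P) (g : P →ₗ[S] X),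
      Module.Finite S P ∧ Module.Projective S P ∧
      Function.Injective f ∧ Function.Exact f g ∧ Function.Surjective g ∧ IsSyzygy S n L K

/-- `X ∈ add U`: `X` is a direct summand of a finite direct sum of copies of `U`. -/
def InAdd (S : Type u) [Ring S] (U X : ModuleCat.{u} S) : Prop :=
  ∃ (Y : ModuleCat.{u} S) (n : ℕ), Nonempty ((X × Y) ≃ₗ[S] (Fin n → U))

/-- There is an exact sequence `0 → U_m → ⋯ → U_1 → U_0 → X → 0` with all `U_i ∈ add U`. -/
def HasAddResolution (S : Type u) [Ring S] (U : ModuleCat.{u} S) : ℕ → ModuleCat.{u} S → Prop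
  | 0, X => InAdd S U X
  | m + 1, X => ∃ (U₀ K : ModuleCat.{u} S) (f : K →ₗ[S] U₀) (g : U₀ →ₗ[S] X),
      InAdd S U U₀ ∧ Function.Injective f ∧ Function.Exact f g ∧ Function.Surjective g ∧
      HasAddResolution S U m K

/-- `mod-R`, the category of finitely generated right `R`-modules, is an `(m,n)`-Igusa-Todorov
category, i.e. `R` is an `(m,n)`-Igusa-Todorov algebra. -/
def IsIgusaTodorovAlgebra (R : Type u) [Ring R] (m n : ℕ) : Prop :=
  ∃ U : ModuleCat.{u} Rᵐᵒᵖ, Module.Finite Rᵐᵒᵖ U ∧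
    ∀ X K : ModuleCat.{u} Rᵐᵒᵖ, Module.Finite Rᵐᵒᵖ X → Module.Finite Rᵐᵒᵖ K →
      IsSyzygy Rᵐᵒᵖ n X K → HasAddResolution Rᵐᵒᵖ U m K

/-- The Igusa-Todorov distance `IT(R)`, i.e. the infimum of all `m` such that `R` is an
`(m,n)`-Igusa-Todorov algebra for some `n` (it is `⊤` if there is no such `m`). -/
noncomputable def igusaTodorovDistance (R : Type u) [Ring R] : ℕ∞ :=
  sInf {d : ℕ∞ | ∃ m : ℕ, d = m ∧ ∃ n : ℕ, IsIgusaTodorovAlgebra R m n}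

/-- `gl.dim R`, the supremum of the projective dimensions of the finitely generated right
`R`-modules. -/
noncomputable def rightGlobalDimension (R : Type u) [Ring R] : WithBot ℕ∞ :=
  ⨆ (X : ModuleCat.{u} Rᵐᵒᵖ) (_ : Module.Finite Rᵐᵒᵖ X), projectiveDimension X

/-! ### Morita context rings with zero bimodule maps -/

/-- The underlying set of the Morita context ring `(A N; M B)`. -/
@[ext]
structure MoritaRing (A N M B : Type u) where
  a : A
  n : N
  m : M
  b : B

namespace MoritaRing

variable {A N M B : Type u} [Ring A] [Ring B]
  [AddCommGroup N] [Module A N] [Module Bᵐᵒᵖ N] [SMulCommClass A Bᵐᵒᵖ N]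
  [AddCommGroup M] [Module B M] [Module Aᵐᵒᵖ M] [SMulCommClass B Aᵐᵒᵖ M]

instance : Zero (MoritaRing A N M B) := ⟨⟨0, 0, 0, 0⟩⟩
instance : One (MoritaRing A N M B) := ⟨⟨1, 0, 0, 1⟩⟩
instance : Add (MoritaRing A N M B) := ⟨fun x y => ⟨x.a + y.a, x.n + y.n, x.m + y.m, x.b + y.b⟩⟩
instance : Neg (MoritaRing A N M B) := ⟨fun x => ⟨-x.a, -x.n, -x.m, -x.b⟩⟩

/-- `(a n; m b) * (a' n'; m' b') = (aa' an'+nb'; ma'+bm' bb')`. -/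
instance : Mul (MoritaRing A N M B) :=
  ⟨fun x y => ⟨x.a * y.a, x.a • y.n + MulOpposite.op y.b • x.n,
    MulOpposite.op y.a • x.m + x.b • y.m, x.b * y.b⟩⟩

instance : Ring (MoritaRing A N M B) :=
  Ring.ofMinimalAxioms
    (fun x y z => MoritaRing.ext (add_assoc _ _ _) (add_assoc _ _ _) (add_assoc _ _ _)
      (add_assoc _ _ _))
    (fun x => MoritaRing.ext (zero_add _) (zero_add _) (zero_add _) (zero_add _))
    (fun x => MoritaRing.ext (neg_add_cancel _) (neg_add_cancel _) (neg_add_cancel _)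
      (neg_add_cancel _))
    (fun x y z => by
      ext
      · exact mul_assoc x.a y.a z.a
      · change (x.a * y.a) • z.n + MulOpposite.op z.b • (x.a • y.n + MulOpposite.op y.b • x.n) =
          x.a • (y.a • z.n + MulOpposite.op z.b • y.n) + MulOpposite.op (y.b * z.b) • x.n
        simp only [smul_add, mul_smul, MulOpposite.op_mul, smul_comm x.a, add_assoc]
      · change MulOpposite.op z.a • (MulOpposite.op y.a • x.m + x.b • y.m) + (x.b * y.b) • z.m =
          MulOpposite.op (y.a * z.a) • x.m + x.b • (MulOpposite.op z.a • y.m + y.b • z.m)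
        simp only [smul_add, mul_smul, MulOpposite.op_mul, smul_comm x.b, add_assoc]
      · exact mul_assoc x.b y.b z.b)
    (fun x => by
      ext
      · exact one_mul x.a
      · change (1 : A) • x.n + MulOpposite.op x.b • (0 : N) = x.n
        simp
      · change MulOpposite.op x.a • (0 : M) + (1 : B) • x.m = x.m
        simp
      · exact one_mul x.b)
    (fun x => by
      ext
      · exact mul_one x.a
      · change x.a • (0 : N) + MulOpposite.op (1 : B) • x.n = x.n
        simp
      · change MulOpposite.op (1 : A) • x.m + x.b • (0 : M) = x.m
        simp
      · exact mul_one x.b)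
    (fun x y z => by
      ext
      · exact mul_add x.a y.a z.a
      · change x.a • (y.n + z.n) + MulOpposite.op (y.b + z.b) • x.n =
          (x.a • y.n + MulOpposite.op y.b • x.n) + (x.a • z.n + MulOpposite.op z.b • x.n)
        simp only [smul_add, add_smul, MulOpposite.op_add]
        abel
      · change MulOpposite.op (y.a + z.a) • x.m + x.b • (y.m + z.m) =
          (MulOpposite.op y.a • x.m + x.b • y.m) + (MulOpposite.op z.a • x.m + x.b • z.m)
        simp only [smul_add, add_smul, MulOpposite.op_add]
        abel
      · exact mul_add x.b y.b z.b)
    (fun x y z => by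
      ext
      · exact add_mul x.a y.a z.a
      · change (x.a + y.a) • z.n + MulOpposite.op z.b • (x.n + y.n) =
          (x.a • z.n + MulOpposite.op z.b • x.n) + (y.a • z.n + MulOpposite.op z.b • y.n)
        simp only [smul_add, add_smul]
        abel
      · change MulOpposite.op z.a • (x.m + y.m) + (x.b + y.b) • z.m =
          (MulOpposite.op z.a • x.m + x.b • z.m) + (MulOpposite.op z.a • y.m + y.b • z.m)
        simp only [smul_add, add_smul]
        abel
      · exact add_mul x.b y.b z.b)

/-- The ring homomorphism `Λ → B`, `(a n; m b) ↦ b`. -/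
def toB : MoritaRing A N M B →+* B where
  toFun x := x.b
  map_one' := rfl
  map_mul' _ _ := rfl
  map_zero' := rfl
  map_add' _ _ := rfl

variable (A N M B) in
/-- The functor `Y ↦ (0, Y, 0, 0)` from right `B`-modules to right `Λ`-modules: a matrix
`(a n; m b)` acts on `y` by `y ↦ yb`. -/
noncomputable abbrev zeroB : ModuleCat.{u} Bᵐᵒᵖ ⥤ ModuleCat.{u} (MoritaRing A N M B)ᵐᵒᵖ :=
  ModuleCat.restrictScalars (RingHom.op (toB : MoritaRing A N M B →+* B))

/-- `P` is a `B`-tight projective `Λ`-module: a finitely generated projective right `Λ`-module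
of the form `(0, Q, 0, 0)`. -/
def IsBTightProjective (P : ModuleCat.{u} (MoritaRing A N M B)ᵐᵒᵖ) : Prop :=
  Module.Finite (MoritaRing A N M B)ᵐᵒᵖ P ∧ Module.Projective (MoritaRing A N M B)ᵐᵒᵖ P ∧
    ∃ Q : ModuleCat.{u} Bᵐᵒᵖ, Nonempty (P ≅ (zeroB A N M B).obj Q)

variable (A N M B) in
/-- The right `B`-module `Y` has a `B`-tight projective `Λ`-resolution: `(0, Y, 0, 0)` has a
projective resolution over `Λ` all of whose terms are `B`-tight. -/
def HasBTightResolution (Y : ModuleCat.{u} Bᵐᵒᵖ) : Prop :=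
  ∃ R : ProjectiveResolution ((zeroB A N M B).obj Y), ∀ i, IsBTightProjective (R.complex.X i)

end MoritaRing

/-! ### Tensor products over noncommutative rings, nilpotent and right perfect bimodules -/

section Tensor

variable (A B N : Type u) [Ring A] [Ring B]
  [AddCommGroup N] [Module A N] [Module Bᵐᵒᵖ N] [SMulCommClass A Bᵐᵒᵖ N]
  (X X' : Type u) [AddCommGroup X] [Module Aᵐᵒᵖ X] [AddCommGroup X'] [Module Aᵐᵒᵖ X']

/-- The relations `xa ⊗ n = x ⊗ an`. The factors are written in the order `N ⊗[ℤ] X`, so that the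
right action of `B` on `N` is the one that Mathlib puts on the tensor product. The set of
generators is stable under this action, so that their `B`-span is the subgroup they generate. -/
def balancedRel : Submodule Bᵐᵒᵖ (N ⊗[ℤ] X) :=
  Submodule.span Bᵐᵒᵖ
    {t | ∃ (a : A) (n : N) (x : X), t = (a • n) ⊗ₜ[ℤ] x - n ⊗ₜ[ℤ] (MulOpposite.op a • x)}

/-- The right `B`-module `X ⊗_A N`, for a right `A`-module `X` and an `A`-`B`-bimodule `N`. -/
abbrev BalancedTensor : Type u := (N ⊗[ℤ] X) ⧸ balancedRel A B N X

variable {X X'} in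
/-- `f ⊗ id_N : X ⊗_A N → X' ⊗_A N`. -/
noncomputable def BalancedTensor.map (f : X →ₗ[Aᵐᵒᵖ] X') :
    BalancedTensor A B N X →ₗ[Bᵐᵒᵖ] BalancedTensor A B N X' :=
  Submodule.mapQ _ _
    (TensorProduct.AlgebraTensorModule.map (LinearMap.id : N →ₗ[Bᵐᵒᵖ] N)
      f.toAddMonoidHom.toIntLinearMap)
    (by
      rw [balancedRel, Submodule.span_le]
      rintro _ ⟨a, n, x, rfl⟩
      refine Submodule.subset_span ⟨a, n, f x, ?_⟩
      simp)

theorem BalancedTensor.map_id :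
    BalancedTensor.map A B N (LinearMap.id : X →ₗ[Aᵐᵒᵖ] X) = LinearMap.id := by
  refine LinearMap.ext fun t => ?_
  obtain ⟨t, rfl⟩ := Submodule.Quotient.mk_surjective _ t
  induction t with
  | zero => rw [Submodule.Quotient.mk_zero, map_zero, map_zero]
  | tmul n x => rfl
  | add s t hs ht => rw [Submodule.Quotient.mk_add, map_add, map_add, hs, ht]

variable {X X'} in
theorem BalancedTensor.map_comp {X'' : Type u} [AddCommGroup X''] [Module Aᵐᵒᵖ X'']
    (g : X' →ₗ[Aᵐᵒᵖ] X'') (f : X →ₗ[Aᵐᵒᵖ] X') :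
    BalancedTensor.map A B N (g ∘ₗ f) = BalancedTensor.map A B N g ∘ₗ BalancedTensor.map A B N f := by
  refine LinearMap.ext fun t => ?_
  obtain ⟨t, rfl⟩ := Submodule.Quotient.mk_surjective _ t
  induction t with
  | zero => rw [Submodule.Quotient.mk_zero, map_zero, map_zero]
  | tmul n x => rfl
  | add s t hs ht => rw [Submodule.Quotient.mk_add, map_add, map_add, hs, ht]

variable {X X'} in
theorem BalancedTensor.map_add (f g : X →ₗ[Aᵐᵒᵖ] X') :
    BalancedTensor.map A B N (f + g) = BalancedTensor.map A B N f + BalancedTensor.map A B N g := by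
  refine LinearMap.ext fun t => ?_
  obtain ⟨t, rfl⟩ := Submodule.Quotient.mk_surjective _ t
  induction t with
  | zero => rw [Submodule.Quotient.mk_zero, map_zero, map_zero]
  | tmul n x =>
    exact congrArg (Submodule.Quotient.mk (p := balancedRel A B N X'))
      (TensorProduct.tmul_add n (f x) (g x))
  | add s t hs ht => rw [Submodule.Quotient.mk_add, _root_.map_add, _root_.map_add, hs, ht]

/-- The functor `- ⊗_A N` from right `A`-modules to right `B`-modules. -/
noncomputable def tensorFunctor : ModuleCat.{u} Aᵐᵒᵖ ⥤ ModuleCat.{u} Bᵐᵒᵖ where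
  obj X := ModuleCat.of Bᵐᵒᵖ (BalancedTensor A B N X)
  map f := ModuleCat.ofHom (BalancedTensor.map A B N f.hom)
  map_id X := ModuleCat.hom_ext (BalancedTensor.map_id A B N X)
  map_comp f g := ModuleCat.hom_ext (BalancedTensor.map_comp A B N g.hom f.hom)

instance : (tensorFunctor A B N).Additive where
  map_add {_ _ f g} := ModuleCat.hom_ext (BalancedTensor.map_add A B N f.hom g.hom)

/-- `Tor_i^A(X, N)`, the `i`-th left derived functor of `- ⊗_A N` at the right `A`-module `X`. -/
noncomputable def balancedTor (i : ℕ) (X : ModuleCat.{u} Aᵐᵒᵖ) : ModuleCat.{u} Bᵐᵒᵖ :=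
  ((tensorFunctor A B N).leftDerived i).obj X

end Tensor

section Bimodule

variable (A N : Type u) [Ring A] [AddCommGroup N] [Module A N] [Module Aᵐᵒᵖ N]
  [SMulCommClass A Aᵐᵒᵖ N]

/-- The tensor power `N^{⊗j}` over `A`, as a right `A`-module. -/
noncomputable def tensorPower : ℕ → ModuleCat.{u} Aᵐᵒᵖ
  | 0 => ModuleCat.of Aᵐᵒᵖ A
  | j + 1 => (tensorFunctor A A N).obj (tensorPower j)

/-- The `A`-bimodule `N` is nilpotent: `N^{⊗n} = 0` for some `n`. -/
def IsNilpotentBimodule : Prop := ∃ n : ℕ, Subsingleton (tensorPower A N n)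

/-- The `A`-bimodule `N` is right perfect: `pd N_A < ∞` and `Tor_i^A(N^{⊗j}, N) = 0` for all
`i, j ≥ 1`. -/
def IsRightPerfect : Prop :=
  projectiveDimension (ModuleCat.of Aᵐᵒᵖ N) < ⊤ ∧
    ∀ i j : ℕ, 1 ≤ i → 1 ≤ j → Subsingleton (balancedTor A A N i (tensorPower A N j))

end Bimodule

/-! A right Λ-module is a pair (X, Y) of a right A-module and a right B-module with maps Y ⊗_B M → X
and X ⊗_A N → Y whose composites vanish. The functor Y ↦ (Y ⊗_B M, Y) is exact because M is left
projective, it preserves finitely generated projectives, and its second component gives Y back. So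
it carries n-syzygies over B to n-syzygies over Λ, and the second component of an add-resolution of
such a syzygy is an add-resolution over B. This is IT(B) ≤ IT(Λ) (`isIgusaTodorovAlgebra_corner`).

For the upper bound, the counit (Y ⊗_B M, Y) → (X, Y) is the identity on Y, so its kernel and
cokernel have the form (X', 0). Suppose that all finitely generated modules of this form have
projective dimension at most d, and pass to (n+d)-syzygies. Those of the kernel and the cokernel are
then projective; the cokernel does not affect the length of a resolution, and the kernel costs one
more term. This even gives IT(Λ) ≤ IT(B) + 1 (`isIgusaTodorovAlgebra_of_zeroA`). Since syzygies
refer to arbitrary presentations, a horseshoe lemma with prescribed syzygies of all three terms is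
needed (`IsExtension.syzygy`); it holds up to projective summands, which can be added to and
cancelled from add-resolutions.

It remains to find d. The functor X ↦ (X, 0) is exact and gl.dim A is finite, so only (A, 0)
matters. In (1), (A, 0) is the quotient of the projective first row (A, N) by (0, N), and a tight
resolution of (0, N) is also one of N over B, whence pd (0, N) ≤ pd N_B. In (2), the sequences 0 →
(N^{⊗(j+1)}, 0) → (N^{⊗(j+1)}, N^{⊗j}) → (0, N^{⊗j}) → 0, whose middle terms have projective
dimension at most gl.dim A, and the symmetry exchanging the two components allow a descending
induction from N^{⊗n} = 0 to N^{⊗0} = A. -/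

set_option linter.unusedSectionVars false

/-! ### Short exact sequences of modules -/

section Extension

variable {S : Type u} [Ring S]

/-- `E` is an extension of `X''` by `X'`: there is a short exact sequence `0 → X' → E → X'' → 0`. -/
def IsExtension (S : Type u) [Ring S] (X' E X'' : Type u) [AddCommGroup X'] [Module S X']
    [AddCommGroup E] [Module S E] [AddCommGroup X''] [Module S X''] : Prop :=
  ∃ (f : X' →ₗ[S] E) (g : E →ₗ[S] X''),
    Function.Injective f ∧ Function.Exact f g ∧ Function.Surjective g

variable {X' E X'' Y' F Y'' : Type u} [AddCommGroup X'] [Module S X']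
  [AddCommGroup E] [Module S E] [AddCommGroup X''] [Module S X'']
  [AddCommGroup Y'] [Module S Y'] [AddCommGroup F] [Module S F] [AddCommGroup Y''] [Module S Y'']

theorem IsExtension.congr (h : IsExtension S X' E X'') (e' : X' ≃ₗ[S] Y') (e : E ≃ₗ[S] F)
    (e'' : X'' ≃ₗ[S] Y'') : IsExtension S Y' F Y'' := by
  obtain ⟨f, g, hf, hfg, hg⟩ := h
  refine ⟨e.toLinearMap ∘ₗ f ∘ₗ e'.symm.toLinearMap, e''.toLinearMap ∘ₗ g ∘ₗ e.symm.toLinearMap,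
    ?_, ?_, ?_⟩
  · simpa using hf
  · intro y
    have := hfg (e.symm y)
    simp only [LinearMap.coe_comp, LinearEquiv.coe_coe, Function.comp_apply,
      LinearEquiv.map_eq_zero_iff, Set.mem_range] at this ⊢
    rw [this]
    constructor
    · rintro ⟨x, hx⟩
      exact ⟨e' x, by simp [hx]⟩
    · rintro ⟨x, rfl⟩
      exact ⟨e'.symm x, by simp⟩
  · simpa using hg

theorem IsExtension.nonempty_equiv_prod [Module.Projective S X''] (h : IsExtension S X' E X'') :
    Nonempty (E ≃ₗ[S] X' × X'') := by
  obtain ⟨f, g, hf, hfg, hg⟩ := h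
  obtain ⟨s, hs⟩ := Module.projective_lifting_property g LinearMap.id hg
  exact ⟨(hfg.splitSurjectiveEquiv hf ⟨s, hs⟩).1⟩

theorem isExtension_ker {g : E →ₗ[S] X''} (hg : Function.Surjective g) :
    IsExtension S (LinearMap.ker g) E X'' :=
  ⟨(LinearMap.ker g).subtype, g, Subtype.val_injective, LinearMap.exact_subtype_ker_map g, hg⟩

theorem isExtension_quotient (p : Submodule S E) : IsExtension S p E (E ⧸ p) :=
  ⟨p.subtype, p.mkQ, Subtype.val_injective, LinearMap.exact_subtype_mkQ p, p.mkQ_surjective⟩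

theorem isExtension_prod : IsExtension S X' (X' × X'') X'' :=
  ⟨LinearMap.inl S X' X'', LinearMap.snd S X' X'', LinearMap.inl_injective,
    Function.Exact.inl_snd, LinearMap.snd_surjective⟩

theorem IsExtension.shortExact {X' E X'' : ModuleCat.{u} S} (h : IsExtension S X' E X'') :
    ∃ C : ShortComplex (ModuleCat.{u} S), C.ShortExact ∧ C.X₁ = X' ∧ C.X₂ = E ∧ C.X₃ = X'' := by
  obtain ⟨f, g, hf, hfg, hg⟩ := h
  refine ⟨ShortComplex.mk (ModuleCat.ofHom f) (ModuleCat.ofHom g) ?_, ?_, rfl, rfl, rfl⟩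
  · ext x
    exact hfg.apply_apply_eq_zero x
  · exact ModuleCat.shortComplex_shortExact _ hfg hf hg

/-- Comparison of presentations in a short exact sequence `0 → X' → X → X'' → 0`: a form of the
horseshoe lemma which applies to a prescribed presentation of the middle term. -/
theorem IsExtension.presentation {X' X X'' P' P P'' L' L L'' : Type u}
    [AddCommGroup X'] [Module S X'] [AddCommGroup X] [Module S X] [AddCommGroup X''] [Module S X'']
    [AddCommGroup P'] [Module S P'] [AddCommGroup P] [Module S P] [AddCommGroup P''] [Module S P'']
    [AddCommGroup L'] [Module S L'] [AddCommGroup L] [Module S L] [AddCommGroup L''] [Module S L'']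
    [Module.Projective S P'] [Module.Projective S P] [Module.Projective S P'']
    (h : IsExtension S X' X X'') (h' : IsExtension S L' P' X') (h₀ : IsExtension S L P X)
    (h'' : IsExtension S L'' P'' X'') :
    IsExtension S L' (L × (P' × P'')) (L'' × P) := by
  obtain ⟨f, g, hf, hfg, hg⟩ := h
  obtain ⟨i', p', hi', hip', hp'⟩ := h'
  obtain ⟨i, p, hi, hip, hp⟩ := h₀
  obtain ⟨i'', p'', hi'', hip'', hp''⟩ := h''
  obtain ⟨σ, hσ⟩ := Module.projective_lifting_property g p'' hg
  have hσ' (c : P'') : g (σ c) = p'' c := LinearMap.congr_fun hσ c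
  have hgf (x : X') : g (f x) = 0 := hfg.apply_apply_eq_zero x
  -- `E` is the pullback of `P → X ← P' × P''`, and `E'` below is that of `P → X'' ← P''`.
  -- Projecting `E` to `P' × P''` and `E'` to `P` splits them as `L × (P' × P'')` and `L'' × P`;
  -- forgetting the `P'` coordinate maps `E` onto `E'` with kernel `L'`.
  let E := LinearMap.ker (p ∘ₗ LinearMap.fst S P (P' × P'') -
    (LinearMap.coprod (f ∘ₗ p') σ) ∘ₗ LinearMap.snd S P (P' × P''))
  have hE (x : P × P' × P'') : x ∈ E ↔ p x.1 = f (p' x.2.1) + σ x.2.2 := by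
    simp [E, sub_eq_zero]
  let E' := LinearMap.ker (g ∘ₗ p ∘ₗ LinearMap.fst S P P'' - p'' ∘ₗ LinearMap.snd S P P'')
  have hE' (x : P × P'') : x ∈ E' ↔ g (p x.1) = p'' x.2 := by
    simp [E', sub_eq_zero]
  have e₁ : IsExtension S L E (P' × P'') := by
    refine ⟨(LinearMap.inl S P (P' × P'') ∘ₗ i).codRestrict E ?_,
      LinearMap.snd S P (P' × P'') ∘ₗ E.subtype, ?_, ?_, ?_⟩
    · intro l
      rw [hE]
      simp [hip.apply_apply_eq_zero l]
    · intro x y hxy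
      apply hi
      simpa using congrArg (fun z : E => z.1.1) hxy
    · rintro ⟨⟨a, b⟩, hx⟩
      rw [hE] at hx
      constructor
      · intro h0
        obtain rfl : b = 0 := h0
        obtain ⟨l, rfl⟩ := (hip a).1 (by simpa using hx)
        exact ⟨l, rfl⟩
      · rintro ⟨l, hl⟩
        exact (congrArg (fun z : E => z.1.2) hl).symm
    · rintro ⟨b, c⟩
      obtain ⟨a, ha⟩ := hp (f (p' b) + σ c)
      exact ⟨⟨(a, b, c), (hE _).2 ha⟩, rfl⟩
  have e₂ : IsExtension S L'' E' P := by
    refine ⟨(LinearMap.inr S P P'' ∘ₗ i'').codRestrict E' ?_,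
      LinearMap.fst S P P'' ∘ₗ E'.subtype, ?_, ?_, ?_⟩
    · intro l
      rw [hE']
      simp [hip''.apply_apply_eq_zero l]
    · intro x y hxy
      apply hi''
      simpa using congrArg (fun z : E' => z.1.2) hxy
    · rintro ⟨⟨a, b⟩, hx⟩
      rw [hE'] at hx
      constructor
      · intro h0
        obtain rfl : a = 0 := h0
        obtain ⟨l, rfl⟩ := (hip'' b).1 (by simpa using hx.symm)
        exact ⟨l, rfl⟩
      · rintro ⟨l, hl⟩
        exact (congrArg (fun z : E' => z.1.1) hl).symm
    · intro a
      obtain ⟨c, hc⟩ := hp'' (g (p a))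
      exact ⟨⟨(a, c), (hE' _).2 hc.symm⟩, rfl⟩
  have e₃ : IsExtension S L' E E' := by
    refine ⟨(LinearMap.inr S P (P' × P'') ∘ₗ LinearMap.inl S P' P'' ∘ₗ i').codRestrict E ?_,
      (LinearMap.prodMap LinearMap.id (LinearMap.snd S P' P'') ∘ₗ E.subtype).codRestrict E' ?_,
      ?_, ?_, ?_⟩
    · intro l
      rw [hE]
      simp [hip'.apply_apply_eq_zero l]
    · rintro ⟨x, hx⟩
      rw [hE] at hx
      rw [hE']
      simp [hx, hσ', hgf]
    · intro x y hxy
      apply hi'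
      simpa using congrArg (fun z : E => z.1.2.1) hxy
    · rintro ⟨⟨a, b, c⟩, hx⟩
      rw [hE] at hx
      constructor
      · intro h0
        obtain rfl : a = 0 := congrArg (fun z : E' => z.1.1) h0
        obtain rfl : c = 0 := congrArg (fun z : E' => z.1.2) h0
        obtain ⟨l, rfl⟩ := (hip' b).1 (hf (by simpa using hx.symm))
        exact ⟨l, rfl⟩
      · rintro ⟨l, hl⟩
        obtain rfl : a = 0 := (congrArg (fun z : E => z.1.1) hl).symm
        obtain rfl : c = 0 := (congrArg (fun z : E => z.1.2.2) hl).symm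
        rfl
    · rintro ⟨⟨a, c⟩, hx⟩
      rw [hE'] at hx
      obtain ⟨x', hx'⟩ := (hfg (p a - σ c)).1 (by simp [hx, hσ'])
      obtain ⟨b, rfl⟩ := hp' x'
      refine ⟨⟨(a, b, c), (hE _).2 (by simp [hx'])⟩, rfl⟩
  obtain ⟨t₁⟩ := e₁.nonempty_equiv_prod
  obtain ⟨t₂⟩ := e₂.nonempty_equiv_prod
  exact e₃.congr (LinearEquiv.refl S L') t₁ t₂

end Extension

/-! ### Projective dimension -/

section ProjectiveDimension

variable {S : Type u} [Ring S] {X' E X'' : ModuleCat.{u} S}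

theorem IsExtension.hasProjectiveDimensionLE_left (h : IsExtension S X' E X'') (n : ℕ)
    (h₂ : HasProjectiveDimensionLE E n) (h₃ : HasProjectiveDimensionLE X'' (n + 1)) :
    HasProjectiveDimensionLE X' n := by
  obtain ⟨C, hC, rfl, rfl, rfl⟩ := h.shortExact
  exact hC.hasProjectiveDimensionLT_X₁ (n + 1) h₂ h₃

theorem IsExtension.hasProjectiveDimensionLE_middle (h : IsExtension S X' E X'') (n : ℕ)
    (h₁ : HasProjectiveDimensionLE X' n) (h₃ : HasProjectiveDimensionLE X'' n) :
    HasProjectiveDimensionLE E n := by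
  obtain ⟨C, hC, rfl, rfl, rfl⟩ := h.shortExact
  exact hC.hasProjectiveDimensionLT_X₂ (n + 1) h₁ h₃

theorem IsExtension.hasProjectiveDimensionLE_right (h : IsExtension S X' E X'') (n : ℕ)
    (h₁ : HasProjectiveDimensionLE X' n) (h₂ : HasProjectiveDimensionLE E (n + 1)) :
    HasProjectiveDimensionLE X'' (n + 1) := by
  obtain ⟨C, hC, rfl, rfl, rfl⟩ := h.shortExact
  exact hC.hasProjectiveDimensionLT_X₃ (n + 1) h₁ h₂

theorem hasProjectiveDimensionLE_mono {X : ModuleCat.{u} S} {m n : ℕ}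
    (h : HasProjectiveDimensionLE X m) (hmn : m ≤ n) : HasProjectiveDimensionLE X n :=
  hasProjectiveDimensionLT_of_ge X (m + 1) (n + 1) (by omega)

theorem hasProjectiveDimensionLE_congr {X Y : ModuleCat.{u} S} {n : ℕ}
    (h : HasProjectiveDimensionLE X n) (e : X ≃ₗ[S] Y) : HasProjectiveDimensionLE Y n :=
  hasProjectiveDimensionLT_of_iso (LinearEquiv.toModuleIso e : X ≅ Y) (n + 1)

theorem hasProjectiveDimensionLE_zero_iff {X : ModuleCat.{u} S} :
    HasProjectiveDimensionLE X 0 ↔ Module.Projective S X :=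
  projective_iff_hasProjectiveDimensionLT_one.symm.trans
    (IsProjective.iff_projective (R := S) (P := X)).symm

theorem hasProjectiveDimensionLE_of_projective (X : ModuleCat.{u} S) [h : Module.Projective S X]
    (n : ℕ) : HasProjectiveDimensionLE X n :=
  hasProjectiveDimensionLE_mono (hasProjectiveDimensionLE_zero_iff.2 h) (Nat.zero_le n)

theorem hasProjectiveDimensionLE_of_subsingleton (X : ModuleCat.{u} S) [Subsingleton X] (n : ℕ) :
    HasProjectiveDimensionLE X n :=
  have : Module.Projective S X := Module.Projective.of_free
  hasProjectiveDimensionLE_of_projective X n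

/-- The functor `F` maps short exact sequences to short exact sequences. -/
def PreservesExtensions {R : Type u} [Ring R] (F : ModuleCat.{u} R ⥤ ModuleCat.{u} S) : Prop :=
  ∀ X' X X'' : ModuleCat.{u} R, IsExtension R X' X X'' →
    IsExtension S (F.obj X') (F.obj X) (F.obj X'')

/-- An exact functor raises the projective dimension of finitely generated modules over a
noetherian ring by at most the projective dimension of its value at the regular module. -/
theorem PreservesExtensions.hasProjectiveDimensionLE_obj {R : Type u} [Ring R] [IsNoetherianRing R]
    {F : ModuleCat.{u} R ⥤ ModuleCat.{u} S} [F.Additive] (hF : PreservesExtensions F)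
    {c : ℕ} (hc : HasProjectiveDimensionLE (F.obj (ModuleCat.of R R)) c) {d : ℕ}
    {X : ModuleCat.{u} R} (hX : Module.Finite R X) (hd : HasProjectiveDimensionLE X d) :
    HasProjectiveDimensionLE (F.obj X) (d + c) := by
  have free (n : ℕ) : HasProjectiveDimensionLE (F.obj (ModuleCat.of R (Fin n → R))) c := by
    induction n with
    | zero =>
      have : Subsingleton (F.obj (ModuleCat.of R (Fin 0 → R))) :=
        ModuleCat.subsingleton_of_isZero
          (F.map_isZero (ModuleCat.isZero_of_subsingleton (ModuleCat.of R (Fin 0 → R))))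
      exact hasProjectiveDimensionLE_of_subsingleton _ c
    | succ n ih =>
      refine (hF (ModuleCat.of R R) (ModuleCat.of R (Fin (n + 1) → R))
        (ModuleCat.of R (Fin n → R)) ?_).hasProjectiveDimensionLE_middle c hc ih
      exact isExtension_prod.congr (LinearEquiv.refl R R)
        (Fin.consLinearEquiv R (fun _ : Fin (n + 1) => R)) (LinearEquiv.refl R (Fin n → R))
  induction d generalizing X with
  | zero =>
    have := hasProjectiveDimensionLE_zero_iff.1 hd
    obtain ⟨n, g, hg⟩ := Module.Finite.exists_fin' R X
    obtain ⟨s, hs⟩ := Module.projective_lifting_property g LinearMap.id hg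
    -- A finitely generated projective is a retract of a free module, and every functor preserves
    -- retracts.
    let r : Retract X (ModuleCat.of R (Fin n → R)) :=
      ⟨ModuleCat.ofHom s, ModuleCat.ofHom g, ModuleCat.hom_ext hs⟩
    have := free n
    rw [Nat.zero_add]
    exact (r.map F).hasProjectiveDimensionLT (c + 1)
  | succ d ih =>
    obtain ⟨n, g, hg⟩ := Module.Finite.exists_fin' R X
    have h : IsExtension R (ModuleCat.of R (LinearMap.ker g)) (ModuleCat.of R (Fin n → R)) X :=
      isExtension_ker hg
    have hK := h.hasProjectiveDimensionLE_left d
      (hasProjectiveDimensionLE_of_projective (ModuleCat.of R (Fin n → R)) d) hd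
    have := (hF _ _ _ h).hasProjectiveDimensionLE_right (d + c) (ih inferInstance hK)
      (hasProjectiveDimensionLE_mono (free n) (by omega))
    rwa [show d + 1 + c = d + c + 1 by omega]

end ProjectiveDimension

/-! ### Direct summands of powers, and resolutions by them -/

section Add

variable {S : Type u} [Ring S]

theorem inAdd_iff {U X : ModuleCat.{u} S} :
    InAdd S U X ↔ ∃ (n : ℕ) (i : X →ₗ[S] Fin n → U) (p : (Fin n → U) →ₗ[S] X),
      p ∘ₗ i = LinearMap.id := by
  constructor
  · rintro ⟨Y, n, ⟨e⟩⟩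
    refine ⟨n, e.toLinearMap ∘ₗ LinearMap.inl S X Y, LinearMap.fst S X Y ∘ₗ e.symm.toLinearMap, ?_⟩
    ext x
    simp
  · rintro ⟨n, i, p, h⟩
    have hp : Function.Surjective p := fun x => ⟨i x, LinearMap.congr_fun h x⟩
    have := ((LinearMap.exact_subtype_ker_map p).splitSurjectiveEquiv
      Subtype.val_injective ⟨i, h⟩).1
    exact ⟨ModuleCat.of S (LinearMap.ker p), n, ⟨(this.trans (LinearEquiv.prodComm S _ _)).symm⟩⟩

/-- Splitting the retraction into coordinates leaves an equation between sums of composites, which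
any additive functor visibly preserves. -/
theorem inAdd_iff_sum {U X : ModuleCat.{u} S} :
    InAdd S U X ↔ ∃ (n : ℕ) (i : Fin n → (X ⟶ U)) (p : Fin n → (U ⟶ X)),
      ∑ k, i k ≫ p k = 𝟙 X := by
  rw [inAdd_iff]
  refine exists_congr fun n => ?_
  constructor
  · rintro ⟨i, p, h⟩
    refine ⟨fun k => ModuleCat.ofHom (LinearMap.proj k ∘ₗ i),
      fun k => ModuleCat.ofHom (p ∘ₗ LinearMap.single S (fun _ => U) k), ?_⟩
    ext x
    have h1 := LinearMap.congr_fun h x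
    simp only [LinearMap.comp_apply, LinearMap.id_apply] at h1
    conv_rhs => rw [ModuleCat.hom_id, LinearMap.id_apply, ← h1,
      ← Finset.univ_sum_single (i x), map_sum]
    simp [ModuleCat.hom_sum]
  · rintro ⟨i, p, h⟩
    refine ⟨LinearMap.pi fun k => (i k).hom, LinearMap.lsum S (fun _ => U) ℕ fun k => (p k).hom, ?_⟩
    ext x
    have := congrArg (fun f => f.hom x) h
    simpa [ModuleCat.hom_sum, LinearMap.lsum_apply] using this

theorem InAdd.obj {R : Type u} [Ring R] (F : ModuleCat.{u} R ⥤ ModuleCat.{u} S) [F.Additive]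
    {U X : ModuleCat.{u} R} (h : InAdd R U X) : InAdd S (F.obj U) (F.obj X) := by
  rw [inAdd_iff_sum] at h ⊢
  obtain ⟨n, i, p, h⟩ := h
  refine ⟨n, fun k => F.map (i k), fun k => F.map (p k), ?_⟩
  simp only [← F.map_comp, ← F.map_sum, h, F.map_id]

theorem InAdd.retract {U X Y : ModuleCat.{u} S} (h : InAdd S U Y) (i : X →ₗ[S] Y) (p : Y →ₗ[S] X)
    (hpi : p ∘ₗ i = LinearMap.id) : InAdd S U X := by
  rw [inAdd_iff] at h ⊢
  obtain ⟨n, j, q, h⟩ := h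
  refine ⟨n, j ∘ₗ i, p ∘ₗ q, ?_⟩
  rw [LinearMap.comp_assoc, ← LinearMap.comp_assoc i, h, LinearMap.id_comp, hpi]

theorem InAdd.congr {U X Y : ModuleCat.{u} S} (h : InAdd S U X) (e : X ≃ₗ[S] Y) : InAdd S U Y :=
  h.retract e.symm.toLinearMap e.toLinearMap (by ext; simp)

theorem InAdd.prod {U X Y : ModuleCat.{u} S} (hX : InAdd S U X) (hY : InAdd S U Y) :
    InAdd S U (ModuleCat.of S (X × Y)) := by
  rw [inAdd_iff] at hX hY
  obtain ⟨m, i, p, h⟩ := hX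
  obtain ⟨n, j, q, h'⟩ := hY
  let e : (Fin (m + n) → U) ≃ₗ[S] (Fin m → U) × (Fin n → U) :=
    (LinearEquiv.funCongrLeft S U finSumFinEquiv).trans (LinearEquiv.sumArrowLequivProdArrow _ _ S U)
  refine inAdd_iff.2 ⟨m + n, e.symm.toLinearMap ∘ₗ i.prodMap j, p.prodMap q ∘ₗ e.toLinearMap, ?_⟩
  ext x
  · simpa using LinearMap.congr_fun h x
  · simp
  · simp
  · simpa using LinearMap.congr_fun h' x

theorem InAdd.of_subsingleton (U X : ModuleCat.{u} S) [Subsingleton X] : InAdd S U X :=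
  inAdd_iff.2 ⟨0, 0, 0, by ext; exact Subsingleton.elim _ _⟩

theorem InAdd.trans {U V X : ModuleCat.{u} S} (h : InAdd S U X) (hU : InAdd S V U) :
    InAdd S V X := by
  obtain ⟨n, i, p, hip⟩ := inAdd_iff.1 h
  have (k : ℕ) : InAdd S V (ModuleCat.of S (Fin k → U)) := by
    induction k with
    | zero => exact InAdd.of_subsingleton V _
    | succ k ih => exact (hU.prod ih).congr (Fin.consLinearEquiv S (fun _ : Fin (k + 1) => U))
  exact (this n).retract i p hip

theorem InAdd.of_projective {U P : ModuleCat.{u} S} [Module.Finite S P] [Module.Projective S P]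
    (hU : InAdd S U (ModuleCat.of S S)) : InAdd S U P := by
  obtain ⟨n, g, hg⟩ := Module.Finite.exists_fin' S P
  obtain ⟨s, hs⟩ := Module.projective_lifting_property g LinearMap.id hg
  exact InAdd.trans (U := ModuleCat.of S S) (inAdd_iff.2 ⟨n, s, g, hs⟩) hU

theorem hasAddResolution_succ_iff {U X : ModuleCat.{u} S} {m : ℕ} :
    HasAddResolution S U (m + 1) X ↔ ∃ U₀ K : ModuleCat.{u} S,
      InAdd S U U₀ ∧ IsExtension S K U₀ X ∧ HasAddResolution S U m K := by
  constructor
  · rintro ⟨U₀, K, f, g, hU, hf, hfg, hg, hK⟩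
    exact ⟨U₀, K, hU, ⟨f, g, hf, hfg, hg⟩, hK⟩
  · rintro ⟨U₀, K, hU, ⟨f, g, hf, hfg, hg⟩, hK⟩
    exact ⟨U₀, K, f, g, hU, hf, hfg, hg, hK⟩

theorem HasAddResolution.congr {U X Y : ModuleCat.{u} S} {m : ℕ} (h : HasAddResolution S U m X)
    (e : X ≃ₗ[S] Y) : HasAddResolution S U m Y := by
  cases m with
  | zero => exact InAdd.congr h e
  | succ m =>
    rw [hasAddResolution_succ_iff] at h ⊢
    obtain ⟨U₀, K, hU, hE, hK⟩ := h
    exact ⟨U₀, K, hU, hE.congr (LinearEquiv.refl S K) (LinearEquiv.refl S U₀) e, hK⟩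

theorem HasAddResolution.trans {U V X : ModuleCat.{u} S} {m : ℕ} (h : HasAddResolution S U m X)
    (hU : InAdd S V U) : HasAddResolution S V m X := by
  induction m generalizing X with
  | zero => exact InAdd.trans h hU
  | succ m ih =>
    rw [hasAddResolution_succ_iff] at h ⊢
    obtain ⟨U₀, K, hU₀, hE, hK⟩ := h
    exact ⟨U₀, K, hU₀.trans hU, hE, ih hK⟩

theorem HasAddResolution.obj {R : Type u} [Ring R] {F : ModuleCat.{u} R ⥤ ModuleCat.{u} S}
    [F.Additive] (hF : PreservesExtensions F) {U X : ModuleCat.{u} R} {m : ℕ}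
    (h : HasAddResolution R U m X) : HasAddResolution S (F.obj U) m (F.obj X) := by
  induction m generalizing X with
  | zero => exact InAdd.obj F h
  | succ m ih =>
    rw [hasAddResolution_succ_iff] at h ⊢
    obtain ⟨U₀, K, hU₀, hE, hK⟩ := h
    exact ⟨F.obj U₀, F.obj K, hU₀.obj F, hF _ _ _ hE, ih hK⟩

theorem HasAddResolution.succ {U X : ModuleCat.{u} S} {m : ℕ} (h : HasAddResolution S U m X) :
    HasAddResolution S U (m + 1) X := by
  induction m generalizing X with
  | zero =>
    refine hasAddResolution_succ_iff.2 ⟨X, ModuleCat.of S PUnit, h, ?_, InAdd.of_subsingleton U _⟩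
    exact ⟨0, LinearMap.id, fun _ _ _ => rfl, fun x => by simp [eq_comm], fun x => ⟨x, rfl⟩⟩
  | succ m ih =>
    rw [hasAddResolution_succ_iff] at h ⊢
    obtain ⟨U₀, K, hU₀, hE, hK⟩ := h
    exact ⟨U₀, K, hU₀, hE, ih hK⟩

theorem HasAddResolution.prod {U X P : ModuleCat.{u} S} {m : ℕ} (h : HasAddResolution S U m X)
    (hP : InAdd S U P) : HasAddResolution S U m (ModuleCat.of S (X × P)) := by
  cases m with
  | zero => exact InAdd.prod h hP
  | succ m =>
    rw [hasAddResolution_succ_iff] at h ⊢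
    obtain ⟨U₀, K, hU₀, ⟨f, g, hf, hfg, hg⟩, hK⟩ := h
    refine ⟨ModuleCat.of S (U₀ × P), K, hU₀.prod hP, ⟨LinearMap.inl S U₀ P ∘ₗ f,
      g.prodMap LinearMap.id, LinearMap.inl_injective.comp hf, ?_, ?_⟩, hK⟩
    · rintro ⟨x, y⟩
      simp only [LinearMap.prodMap_apply, Prod.mk_eq_zero, hfg x, LinearMap.id_apply,
        LinearMap.coe_comp, Set.mem_range, Function.comp_apply, LinearMap.coe_inl, Prod.mk.injEq]
      constructor
      · rintro ⟨⟨k, rfl⟩, rfl⟩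
        exact ⟨k, rfl, rfl⟩
      · rintro ⟨k, rfl, rfl⟩
        exact ⟨⟨k, rfl⟩, rfl⟩
    · exact hg.prodMap Function.surjective_id

/-- The composite `U₀ → X × P → P` splits, so its kernel `W` is a summand of `U₀`; it maps onto `X`
with the same kernel `K` as before. -/
theorem HasAddResolution.of_prod {U X P : ModuleCat.{u} S} [Module.Projective S P] {m : ℕ}
    (h : HasAddResolution S U m (ModuleCat.of S (X × P))) : HasAddResolution S U m X := by
  cases m with
  | zero =>
    exact InAdd.retract h (LinearMap.inl S X P) (LinearMap.fst S X P)
      (LinearMap.fst_comp_inl S X P)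
  | succ m =>
    rw [hasAddResolution_succ_iff] at h ⊢
    obtain ⟨U₀, K, hU₀, ⟨f, g, hf, hfg, hg⟩, hK⟩ := h
    let W := LinearMap.ker (LinearMap.snd S X P ∘ₗ g)
    obtain ⟨e⟩ := (isExtension_ker (g := LinearMap.snd S X P ∘ₗ g)
      (Prod.snd_surjective.comp hg)).nonempty_equiv_prod
    refine ⟨ModuleCat.of S W, K, hU₀.retract (e.symm.toLinearMap ∘ₗ LinearMap.inl S W P)
      (LinearMap.fst S W P ∘ₗ e.toLinearMap) (by ext; simp), ⟨f.codRestrict W ?_,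
      LinearMap.fst S X P ∘ₗ g ∘ₗ W.subtype, ?_, ?_, ?_⟩, hK⟩
    · intro k
      simp [W, hfg.apply_apply_eq_zero k]
    · exact fun x y hxy => hf (congrArg Subtype.val hxy)
    · rintro ⟨x, hx⟩
      have hx' : (g x).2 = 0 := hx
      constructor
      · intro h0
        obtain ⟨k, rfl⟩ := (hfg x).1 (Prod.ext h0 hx')
        exact ⟨k, rfl⟩
      · rintro ⟨k, hk⟩
        obtain rfl : f k = x := congrArg Subtype.val hk
        simp [hfg.apply_apply_eq_zero k]
    · intro x
      obtain ⟨z, hz⟩ := hg (x, 0)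
      exact ⟨⟨z, by simp [W, hz]⟩, by simp [hz]⟩

/-- If `0 → P → E → X → 0` is exact with `P` projective in `add U`, then a resolution of `E` gives
a resolution of `X`. -/
theorem HasAddResolution.of_isExtension {U P E X : ModuleCat.{u} S} [Module.Projective S P]
    (hP : InAdd S U P) (hE : IsExtension S P E X) {m : ℕ} (h : HasAddResolution S U m E) :
    HasAddResolution S U (m + 1) X := by
  cases m with
  | zero => exact hasAddResolution_succ_iff.2 ⟨E, P, h, hE, hP⟩
  | succ m =>
    -- In positive length the extra term is mere padding: the kernel of `U₀ → E → X` is an extension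
    -- of `P` by `K`, hence `K × P`, and `P` is absorbed into the resolution of `K`.
    refine HasAddResolution.succ ?_
    rw [hasAddResolution_succ_iff] at h ⊢
    obtain ⟨U₀, K, hU₀, ⟨f, g, hf, hfg, hg⟩, hK⟩ := h
    obtain ⟨i, p, hi, hip, hp⟩ := hE
    refine ⟨U₀, ModuleCat.of S (LinearMap.ker (p ∘ₗ g)), hU₀, isExtension_ker (hp.comp hg), ?_⟩
    have hker : LinearMap.ker p = LinearMap.range i := LinearMap.exact_iff.1 hip
    have key : IsExtension S K (LinearMap.ker (p ∘ₗ g)) (LinearMap.ker p) := by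
      refine ⟨f.codRestrict _ fun k => by simp [hfg.apply_apply_eq_zero k],
        (g ∘ₗ (LinearMap.ker (p ∘ₗ g)).subtype).codRestrict _ fun x => x.2,
        fun x y hxy => hf (congrArg Subtype.val hxy), ?_, ?_⟩
      · rintro ⟨x, hx⟩
        constructor
        · intro h0
          obtain ⟨k, rfl⟩ := (hfg x).1 (congrArg Subtype.val h0)
          exact ⟨k, rfl⟩
        · rintro ⟨k, hk⟩
          obtain rfl : f k = x := congrArg Subtype.val hk
          exact Subtype.ext (hfg.apply_apply_eq_zero k)
      · rintro ⟨y, hy⟩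
        obtain ⟨x, rfl⟩ := hg y
        exact ⟨⟨x, hy⟩, rfl⟩
    obtain ⟨e⟩ := (key.congr (LinearEquiv.refl S K) (LinearEquiv.refl S _)
      ((LinearEquiv.ofEq _ _ hker).trans (LinearEquiv.ofInjective i hi).symm)).nonempty_equiv_prod
    exact (hK.prod hP).congr e.symm

end Add

/-! ### Syzygies -/

section Syzygy

variable {S : Type u} [Ring S]

theorem isSyzygy_succ_iff {X K : ModuleCat.{u} S} {n : ℕ} :
    IsSyzygy S (n + 1) X K ↔ ∃ P L : ModuleCat.{u} S, Module.Finite S P ∧ Module.Projective S P ∧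
      IsExtension S L P X ∧ IsSyzygy S n L K := by
  constructor
  · rintro ⟨P, L, f, g, h₁, h₂, hf, hfg, hg, h⟩
    exact ⟨P, L, h₁, h₂, ⟨f, g, hf, hfg, hg⟩, h⟩
  · rintro ⟨P, L, h₁, h₂, ⟨f, g, hf, hfg, hg⟩, h⟩
    exact ⟨P, L, f, g, h₁, h₂, hf, hfg, hg, h⟩

theorem IsExtension.finite_left [IsNoetherianRing S] {X' E X'' : Type u} [AddCommGroup X']
    [Module S X'] [AddCommGroup E] [Module S E] [AddCommGroup X''] [Module S X'']
    [Module.Finite S E] (h : IsExtension S X' E X'') : Module.Finite S X' := by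
  obtain ⟨f, g, hf, -, -⟩ := h
  exact Module.Finite.of_injective f hf

theorem IsExtension.finite_right {X' E X'' : Type u} [AddCommGroup X']
    [Module S X'] [AddCommGroup E] [Module S E] [AddCommGroup X''] [Module S X'']
    [Module.Finite S E] (h : IsExtension S X' E X'') : Module.Finite S X'' := by
  obtain ⟨f, g, -, -, hg⟩ := h
  exact Module.Finite.of_surjective g hg

theorem exists_isExtension_projective (X : ModuleCat.{u} S) [Module.Finite S X] :
    ∃ P L : ModuleCat.{u} S, Module.Finite S P ∧ Module.Projective S P ∧ IsExtension S L P X := by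
  obtain ⟨n, g, hg⟩ := Module.Finite.exists_fin' S X
  exact ⟨ModuleCat.of S (Fin n → S), ModuleCat.of S (LinearMap.ker g), inferInstance, inferInstance,
    isExtension_ker hg⟩

theorem exists_isSyzygy [IsNoetherianRing S] (n : ℕ) (X : ModuleCat.{u} S) [Module.Finite S X] :
    ∃ K, IsSyzygy S n X K := by
  induction n generalizing X with
  | zero => exact ⟨X, ⟨LinearEquiv.refl S X⟩⟩
  | succ n ih =>
    obtain ⟨P, L, h₁, h₂, h⟩ := exists_isExtension_projective X
    have := h.finite_left
    obtain ⟨K, hK⟩ := ih L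
    exact ⟨K, isSyzygy_succ_iff.2 ⟨P, L, h₁, h₂, h, hK⟩⟩

theorem IsSyzygy.finite [IsNoetherianRing S] {n : ℕ} {X K : ModuleCat.{u} S} [Module.Finite S X]
    (h : IsSyzygy S n X K) : Module.Finite S K := by
  induction n generalizing X with
  | zero =>
    obtain ⟨e⟩ := h
    exact Module.Finite.equiv e.symm
  | succ n ih =>
    obtain ⟨P, L, h₁, h₂, h, hK⟩ := isSyzygy_succ_iff.1 h
    have := h.finite_left
    exact ih hK

/-- Each step lowers the bound by one whatever presentation is chosen, so syzygies need not be
compared with one another. -/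
theorem IsSyzygy.projective {n : ℕ} {X K : ModuleCat.{u} S} (h : IsSyzygy S n X K)
    (hX : HasProjectiveDimensionLE X n) : Module.Projective S K := by
  induction n generalizing X with
  | zero =>
    obtain ⟨e⟩ := h
    exact hasProjectiveDimensionLE_zero_iff.1 (hasProjectiveDimensionLE_congr hX e.symm)
  | succ n ih =>
    obtain ⟨P, L, h₁, h₂, h, hK⟩ := isSyzygy_succ_iff.1 h
    exact ih hK (h.hasProjectiveDimensionLE_left n (hasProjectiveDimensionLE_of_projective P n) hX)

theorem IsSyzygy.obj {R : Type u} [Ring R] {F : ModuleCat.{u} R ⥤ ModuleCat.{u} S}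
    (hF : PreservesExtensions F)
    (hP : ∀ P : ModuleCat.{u} R, Module.Finite R P → Module.Projective R P →
      Module.Finite S (F.obj P) ∧ Module.Projective S (F.obj P))
    {n : ℕ} {X K : ModuleCat.{u} R} (h : IsSyzygy R n X K) : IsSyzygy S n (F.obj X) (F.obj K) := by
  induction n generalizing X with
  | zero =>
    obtain ⟨e⟩ := h
    exact ⟨(F.mapIso e.toModuleIso).toLinearEquiv⟩
  | succ n ih =>
    obtain ⟨P, L, h₁, h₂, h, hK⟩ := isSyzygy_succ_iff.1 h
    exact isSyzygy_succ_iff.2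
      ⟨F.obj P, F.obj L, (hP P h₁ h₂).1, (hP P h₁ h₂).2, hF _ _ _ h, ih hK⟩

/-- Of the two copies of `P` in `Q × (P × P)`, one covers the summand `P` of `X × P` and the other
is passed on to the kernel `L × P`. This carries the summands produced by `IsExtension.presentation`
through the induction in `IsExtension.syzygy`. -/
theorem IsSyzygy.prod {n : ℕ} {X K P : ModuleCat.{u} S} [hf : Module.Finite S P]
    [hp : Module.Projective S P] (h : IsSyzygy S n X K) :
    IsSyzygy S n (ModuleCat.of S (X × P)) (ModuleCat.of S (K × P)) := by
  induction n generalizing X with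
  | zero =>
    obtain ⟨e⟩ := h
    exact ⟨e.prodCongr (LinearEquiv.refl S P)⟩
  | succ n ih =>
    obtain ⟨Q, L, h₁, h₂, ⟨f, g, hf', hfg, hg⟩, hK⟩ := isSyzygy_succ_iff.1 h
    refine isSyzygy_succ_iff.2 ⟨ModuleCat.of S (Q × (P × P)), ModuleCat.of S (L × P),
      inferInstanceAs (Module.Finite S (Q × (P × P))),
      inferInstanceAs (Module.Projective S (Q × (P × P))), ⟨f.prodMap (LinearMap.inl S P P),
      g.prodMap (LinearMap.snd S P P), ?_, ?_, ?_⟩, ih hK⟩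
    · exact hf'.prodMap LinearMap.inl_injective
    · rintro ⟨x, y, z⟩
      simp only [LinearMap.prodMap_apply, Prod.mk_eq_zero, hfg x, LinearMap.snd_apply,
        Set.mem_range, Prod.exists, LinearMap.coe_inl, Prod.mk.injEq]
      constructor
      · rintro ⟨⟨k, rfl⟩, rfl⟩
        exact ⟨k, y, rfl, rfl, rfl⟩
      · rintro ⟨k, y, rfl, rfl, rfl⟩
        exact ⟨⟨k, rfl⟩, rfl⟩
    · exact hg.prodMap Prod.snd_surjective

/-- The horseshoe lemma for prescribed `n`-syzygies of the terms of a short exact sequence. -/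
theorem IsExtension.syzygy {n : ℕ} {X' X X'' K' K K'' : ModuleCat.{u} S}
    (h : IsExtension S X' X X'') (h' : IsSyzygy S n X' K') (h₀ : IsSyzygy S n X K)
    (h'' : IsSyzygy S n X'' K'') :
    ∃ P Q : ModuleCat.{u} S, Module.Finite S P ∧ Module.Projective S P ∧
      Module.Finite S Q ∧ Module.Projective S Q ∧ IsExtension S K' (K × P) (K'' × Q) := by
  induction n generalizing X' X X'' K K'' with
  | zero =>
    obtain ⟨e'⟩ := h'
    obtain ⟨e⟩ := h₀
    obtain ⟨e''⟩ := h''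
    have i : Module.Projective S PUnit.{u + 1} := Module.Projective.of_free
    have j : Module.Finite S PUnit.{u + 1} := inferInstance
    exact ⟨ModuleCat.of S PUnit, ModuleCat.of S PUnit, j, i, j, i,
      h.congr e'.symm (e.symm.trans LinearEquiv.prodUnique.symm)
        (e''.symm.trans LinearEquiv.prodUnique.symm)⟩
  | succ n ih =>
    obtain ⟨P', L', hf', hp', hL', hK'⟩ := isSyzygy_succ_iff.1 h'
    obtain ⟨P, L, hf, hp, hL, hK⟩ := isSyzygy_succ_iff.1 h₀
    obtain ⟨P'', L'', hf'', hp'', hL'', hK''⟩ := isSyzygy_succ_iff.1 h''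
    have i₁ : Module.Finite S (ModuleCat.of S (P' × P'')) :=
      inferInstanceAs (Module.Finite S (P' × P''))
    have i₂ : Module.Projective S (ModuleCat.of S (P' × P'')) :=
      inferInstanceAs (Module.Projective S (P' × P''))
    -- Only the middle and right terms acquire projective summands, so `K'` stays fixed throughout
    -- the induction.
    obtain ⟨P₁, Q₁, j₁, j₂, j₃, j₄, hE⟩ := ih (X := ModuleCat.of S (L × ModuleCat.of S (P' × P'')))
      (X'' := ModuleCat.of S (L'' × P)) (h.presentation hL' hL hL'') hK' hK.prod hK''.prod
    exact ⟨ModuleCat.of S ((P' × P'') × P₁), ModuleCat.of S (P × Q₁),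
      inferInstanceAs (Module.Finite S ((P' × P'') × P₁)),
      inferInstanceAs (Module.Projective S ((P' × P'') × P₁)),
      inferInstanceAs (Module.Finite S (P × Q₁)), inferInstanceAs (Module.Projective S (P × Q₁)),
      hE.congr (LinearEquiv.refl S K') (LinearEquiv.prodAssoc S K (P' × P'') P₁)
        (LinearEquiv.prodAssoc S K'' P Q₁)⟩

/-- If the cokernel term of a short exact sequence has projective dimension at most `n`, then the
`n`-syzygies of the middle term are resolved like those of the kernel term. -/
theorem IsExtension.hasAddResolution_middle {n m : ℕ} {X' X X'' K' K K'' U : ModuleCat.{u} S}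
    (hU : InAdd S U (ModuleCat.of S S)) (h : IsExtension S X' X X'')
    (h' : IsSyzygy S n X' K') (h₀ : IsSyzygy S n X K) (h'' : IsSyzygy S n X'' K'')
    [Module.Finite S K''] [Module.Projective S K''] (hK' : HasAddResolution S U m K') :
    HasAddResolution S U m K := by
  obtain ⟨P, Q, hP, hP', hQ, hQ', hE⟩ := h.syzygy h' h₀ h''
  -- The right term `K'' × Q` is projective, so `K × P ≅ K' × (K'' × Q)`, and `P` can be cancelled.
  obtain ⟨e⟩ := hE.nonempty_equiv_prod
  have i₁ : Module.Finite S (ModuleCat.of S (K'' × Q)) := inferInstanceAs (Module.Finite S (K'' × Q))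
  have i₂ : Module.Projective S (ModuleCat.of S (K'' × Q)) :=
    inferInstanceAs (Module.Projective S (K'' × Q))
  have := hK'.prod (InAdd.of_projective (P := ModuleCat.of S (K'' × Q)) hU)
  exact HasAddResolution.of_prod (P := P) (this.congr e.symm)

/-- If the kernel term of a short exact sequence has projective `n`-syzygies, then resolutions of
the `n`-syzygies of the middle term yield resolutions of those of the cokernel term. -/
theorem IsExtension.hasAddResolution_right {n m : ℕ} {X' X X'' K' K K'' U : ModuleCat.{u} S}
    (hU : InAdd S U (ModuleCat.of S S)) (h : IsExtension S X' X X'')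
    (h' : IsSyzygy S n X' K') (h₀ : IsSyzygy S n X K) (h'' : IsSyzygy S n X'' K'')
    [Module.Finite S K'] [Module.Projective S K'] (hK : HasAddResolution S U m K) :
    HasAddResolution S U (m + 1) K'' := by
  obtain ⟨P, Q, hP, hP', hQ, hQ', hE⟩ := h.syzygy h' h₀ h''
  have := HasAddResolution.of_isExtension (E := ModuleCat.of S (K × P))
    (X := ModuleCat.of S (K'' × Q)) (InAdd.of_projective hU) hE
    (hK.prod (InAdd.of_projective hU))
  exact this.of_prod

end Syzygy

/-! ### Exactness of the balanced tensor product -/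

namespace BalancedTensor

variable {A B N : Type u} [Ring A] [Ring B]
  [AddCommGroup N] [Module A N] [Module Bᵐᵒᵖ N] [SMulCommClass A Bᵐᵒᵖ N]
  {X X' X'' : Type u} [AddCommGroup X] [Module Aᵐᵒᵖ X] [AddCommGroup X'] [Module Aᵐᵒᵖ X']
  [AddCommGroup X''] [Module Aᵐᵒᵖ X'']

variable (A B) in
/-- The pure tensor `x ⊗ n` in `X ⊗_A N`, biadditively in `n` and `x`. -/
noncomputable def tmul : N →+ X →+ BalancedTensor A B N X :=
  AddMonoidHom.mk' (fun n => AddMonoidHom.mk' (fun x => (balancedRel A B N X).mkQ (n ⊗ₜ[ℤ] x))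
    fun x y => by rw [TensorProduct.tmul_add, _root_.map_add]) fun n n' => by
    ext x
    exact (congrArg _ (TensorProduct.add_tmul n n' x)).trans
      (_root_.map_add (balancedRel A B N X).mkQ (n ⊗ₜ[ℤ] x) (n' ⊗ₜ[ℤ] x))

theorem smul_tmul (a : A) (n : N) (x : X) :
    tmul A B (a • n) x = tmul A B n (MulOpposite.op a • x) :=
  (Submodule.Quotient.eq _).2 (Submodule.subset_span ⟨a, n, x, rfl⟩)

theorem op_smul_tmul (b : Bᵐᵒᵖ) (n : N) (x : X) : b • tmul A B n x = tmul A B (b • n) x := rfl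

theorem map_tmul (f : X →ₗ[Aᵐᵒᵖ] X') (n : N) (x : X) :
    BalancedTensor.map A B N f (tmul A B n x) = tmul A B n (f x) := rfl

theorem induction_on {p : BalancedTensor A B N X → Prop} (t : BalancedTensor A B N X)
    (zero : p 0) (tmul : ∀ n x, p (tmul A B n x)) (add : ∀ s t, p s → p t → p (s + t)) : p t := by
  obtain ⟨t, rfl⟩ := Submodule.Quotient.mk_surjective _ t
  induction t with
  | zero => exact zero
  | tmul n x => exact tmul n x
  | add s t hs ht => exact add _ _ hs ht

/-- Balanced biadditive maps factor through the tensor product. -/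
noncomputable def lift {G : Type*} [AddCommGroup G] (φ : N →+ X →+ G)
    (h : ∀ (a : A) (n : N) (x : X), φ (a • n) x = φ n (MulOpposite.op a • x)) :
    BalancedTensor A B N X →+ G :=
  QuotientAddGroup.lift (balancedRel A B N X).toAddSubgroup
    (TensorProduct.liftAddHom φ fun r n x => by simp) <| by
    intro t ht
    -- The relations form a `B`-span while `φ` is only additive; proving vanishing on all `b • t` at
    -- once makes the scalar step of the span induction trivial.
    suffices ∀ b : Bᵐᵒᵖ, TensorProduct.liftAddHom φ (fun r n x => by simp) (b • t) = 0 by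
      simpa using this 1
    change t ∈ balancedRel A B N X at ht
    induction ht using Submodule.span_induction with
    | mem t ht =>
      obtain ⟨a, n, x, rfl⟩ := ht
      intro b
      rw [smul_sub, TensorProduct.smul_tmul', TensorProduct.smul_tmul', _root_.map_sub, sub_eq_zero,
        ← smul_comm a b n]
      exact h a (b • n) x
    | zero => simp
    | add s t _ _ hs ht =>
      intro b
      rw [smul_add, _root_.map_add, hs, ht, add_zero]
    | smul c t _ ht =>
      intro b
      rw [smul_smul, ht]

theorem map_surjective {f : X →ₗ[Aᵐᵒᵖ] X'} (hf : Function.Surjective f) :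
    Function.Surjective (BalancedTensor.map A B N f) := by
  intro t
  induction t using induction_on with
  | zero => exact ⟨0, map_zero _⟩
  | tmul n x =>
    obtain ⟨y, rfl⟩ := hf x
    exact ⟨tmul A B n y, rfl⟩
  | add s t hs ht =>
    obtain ⟨s, rfl⟩ := hs
    obtain ⟨t, rfl⟩ := ht
    exact ⟨s + t, _root_.map_add _ _ _⟩

/-- Lifting elements of `X''` to `X` defines a map from `X'' ⊗ N` to the cokernel of `f ⊗ N`: two
lifts differ by an element of the image of `f`. The quotient map factors through `g ⊗ N` by this
map, so the kernel of `g ⊗ N` lies in the image of `f ⊗ N`. -/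
theorem map_exact {f : X' →ₗ[Aᵐᵒᵖ] X} {g : X →ₗ[Aᵐᵒᵖ] X''} (hfg : Function.Exact f g)
    (hg : Function.Surjective g) :
    Function.Exact (BalancedTensor.map A B N f) (BalancedTensor.map A B N g) := by
  intro t
  constructor
  · let q := (LinearMap.range (BalancedTensor.map A B N f)).mkQ.toAddMonoidHom
    have hq (n : N) (x : X) (hx : g x = 0) : q (tmul A B n x) = 0 := by
      obtain ⟨y, rfl⟩ := (hfg x).1 hx
      exact (Submodule.Quotient.mk_eq_zero _).2 ⟨tmul A B n y, rfl⟩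
    have hq' (n : N) (x y : X) (hxy : g x = g y) : q (tmul A B n x) = q (tmul A B n y) := by
      rw [← sub_eq_zero, ← _root_.map_sub, ← _root_.map_sub]
      exact hq n _ (by rw [_root_.map_sub, hxy, sub_self])
    let s := Function.surjInv hg
    have hs (x : X'') : g (s x) = x := Function.surjInv_eq hg x
    let φ : N →+ X'' →+ (BalancedTensor A B N X ⧸ LinearMap.range (BalancedTensor.map A B N f)) :=
      AddMonoidHom.mk' (fun n => AddMonoidHom.mk' (fun x => q (tmul A B n (s x))) fun x y => by
        rw [← _root_.map_add, ← _root_.map_add]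
        exact hq' _ _ _ (by simp [hs])) fun n n' => by
        ext x
        simp
    have hφ (n : N) (x : X) : φ n (g x) = q (tmul A B n x) := hq' _ _ _ (hs _)
    let r : BalancedTensor A B N X'' →+ _ := lift (B := B) φ fun a n x => by
      obtain ⟨x, rfl⟩ := hg x
      rw [← map_smul, hφ, hφ, smul_tmul]
    have hr (t : BalancedTensor A B N X) : r (BalancedTensor.map A B N g t) = q t := by
      induction t using induction_on with
      | zero => simp
      | tmul n x => exact hφ n x
      | add s t hs ht => rw [_root_.map_add, _root_.map_add, hs, ht, _root_.map_add]
    intro ht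
    have := hr t
    rw [ht, map_zero] at this
    exact (Submodule.Quotient.mk_eq_zero _).1 this.symm
  · rintro ⟨t, rfl⟩
    have : g ∘ₗ f = 0 := LinearMap.ext hfg.apply_apply_eq_zero
    rw [← LinearMap.comp_apply, ← BalancedTensor.map_comp, this]
    induction t using induction_on with
    | zero => simp
    | tmul n x => exact map_zero (tmul A B n)
    | add s t hs ht => rw [_root_.map_add, hs, ht, add_zero]

/-- A dual basis `σ` of the projective left module `N` gives coordinates x ⊗ n ↦ (x σ(n)_i)_i,
natural in the right module and with left inverse `back`. So `X ⊗ N` embeds in a direct sum of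
copies of `X`, where injectivity is checked coordinatewise. -/
theorem map_injective [Module.Projective A N] {f : X →ₗ[Aᵐᵒᵖ] X'} (hf : Function.Injective f) :
    Function.Injective (BalancedTensor.map A B N f) := by
  obtain ⟨σ, hσ⟩ := Module.projective_def'.1 (inferInstance : Module.Projective A N)
  have hσ' (n : N) : (σ n).sum (fun i a => a • i) = n := LinearMap.congr_fun hσ n
  let coord (Z : Type u) [AddCommGroup Z] [Module Aᵐᵒᵖ Z] : BalancedTensor A B N Z →+ (N →₀ Z) :=
    lift (B := B) (AddMonoidHom.mk' (fun n => AddMonoidHom.mk'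
      (fun z => (σ n).mapRange (fun a => MulOpposite.op a • z) (by simp))
      fun z z' => by ext; simp) fun n n' => by ext; simp [add_smul]) fun a n z => by
        ext i
        simp [mul_smul]
  let back : (N →₀ X) →+ BalancedTensor A B N X := Finsupp.liftAddHom fun n => tmul A B n
  have hback (t : BalancedTensor A B N X) : back (coord X t) = t := by
    induction t using induction_on with
    | zero => simp
    | tmul n x =>
      conv_rhs => rw [← hσ' n]
      change ((σ n).mapRange (fun a => MulOpposite.op a • x) (by simp)).sum (fun i z => tmul A B i z) = _
      rw [Finsupp.sum_mapRange_index (by simp), Finsupp.sum, Finsupp.sum, map_sum,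
        AddMonoidHom.finsetSum_apply]
      exact Finset.sum_congr rfl fun i _ => (smul_tmul _ _ _).symm
    | add s t hs ht => rw [_root_.map_add, _root_.map_add, hs, ht]
  have hmap (t : BalancedTensor A B N X) (i : N) :
      coord X' (BalancedTensor.map A B N f t) i = f (coord X t i) := by
    induction t using induction_on with
    | zero => simp
    | tmul n x => exact (map_smul f _ _).symm
    | add s t hs ht =>
      rw [_root_.map_add, _root_.map_add, _root_.map_add, Finsupp.add_apply, hs, ht,
        Finsupp.add_apply, _root_.map_add]
  rw [injective_iff_map_eq_zero]
  intro t ht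
  have : coord X t = 0 := by
    ext i
    apply hf
    rw [← hmap, ht]
    simp
  rw [← hback t, this, map_zero]

end BalancedTensor

/-! ### Entrywise rules in Λ and inflation along Λ → A. -/

namespace MoritaRing

variable {A N M B : Type u} [Ring A] [Ring B]
  [AddCommGroup N] [Module A N] [Module Bᵐᵒᵖ N] [SMulCommClass A Bᵐᵒᵖ N]
  [AddCommGroup M] [Module B M] [Module Aᵐᵒᵖ M] [SMulCommClass B Aᵐᵒᵖ M]

@[simp] theorem zero_a : (0 : MoritaRing A N M B).a = 0 := rfl
@[simp] theorem zero_n : (0 : MoritaRing A N M B).n = 0 := rfl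
@[simp] theorem zero_m : (0 : MoritaRing A N M B).m = 0 := rfl
@[simp] theorem zero_b : (0 : MoritaRing A N M B).b = 0 := rfl
@[simp] theorem one_a : (1 : MoritaRing A N M B).a = 1 := rfl
@[simp] theorem one_n : (1 : MoritaRing A N M B).n = 0 := rfl
@[simp] theorem one_m : (1 : MoritaRing A N M B).m = 0 := rfl
@[simp] theorem one_b : (1 : MoritaRing A N M B).b = 1 := rfl

section

variable (x y : MoritaRing A N M B)

@[simp] theorem add_a : (x + y).a = x.a + y.a := rfl
@[simp] theorem add_n : (x + y).n = x.n + y.n := rfl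
@[simp] theorem add_m : (x + y).m = x.m + y.m := rfl
@[simp] theorem add_b : (x + y).b = x.b + y.b := rfl
@[simp] theorem mul_a : (x * y).a = x.a * y.a := rfl
@[simp] theorem mul_n : (x * y).n = x.a • y.n + MulOpposite.op y.b • x.n := rfl
@[simp] theorem mul_m : (x * y).m = MulOpposite.op y.a • x.m + x.b • y.m := rfl
@[simp] theorem mul_b : (x * y).b = x.b * y.b := rfl

end

/-- The ring homomorphism `Λ → A`, `(a n; m b) ↦ a`. -/
def toA : MoritaRing A N M B →+* A where
  toFun x := x.a
  map_one' := rfl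
  map_mul' _ _ := rfl
  map_zero' := rfl
  map_add' _ _ := rfl

variable (A N M B) in
/-- The functor `X ↦ (X, 0, 0, 0)` from right `A`-modules to right `Λ`-modules. -/
noncomputable abbrev zeroA : ModuleCat.{u} Aᵐᵒᵖ ⥤ ModuleCat.{u} (MoritaRing A N M B)ᵐᵒᵖ :=
  ModuleCat.restrictScalars (RingHom.op (toA : MoritaRing A N M B →+* A))

theorem preservesExtensions_restrictScalars {R S : Type u} [Ring R] [Ring S] (f : R →+* S) :
    PreservesExtensions (ModuleCat.restrictScalars.{u} f) := by
  rintro X' X X'' ⟨i, p, hi, hip, hp⟩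
  exact ⟨((ModuleCat.restrictScalars f).map (ModuleCat.ofHom i)).hom,
    ((ModuleCat.restrictScalars f).map (ModuleCat.ofHom p)).hom, hi, hip, hp⟩

/-! ### The functor `Y ↦ (Y ⊗_B M, Y)` -/

/-- The right `Λ`-module `(Y ⊗_B M, Y)`. -/
@[ext, nolint unusedArguments]
structure Induced (A N M B : Type u) [Ring A] [Ring B] [AddCommGroup M] [Module B M] [Module Aᵐᵒᵖ M]
    [SMulCommClass B Aᵐᵒᵖ M] (Y : Type u) [AddCommGroup Y] [Module Bᵐᵒᵖ Y] : Type u where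
  left : BalancedTensor B A M Y
  right : Y

section Induced

variable {Y Y' Y'' : Type u} [AddCommGroup Y] [Module Bᵐᵒᵖ Y] [AddCommGroup Y'] [Module Bᵐᵒᵖ Y']
  [AddCommGroup Y''] [Module Bᵐᵒᵖ Y'']

variable (A N M B Y) in
/-- The components of an element of `(Y ⊗_B M, Y)`. -/
def Induced.equivProd : Induced A N M B Y ≃ BalancedTensor B A M Y × Y where
  toFun x := (x.left, x.right)
  invFun x := ⟨x.1, x.2⟩

noncomputable instance : AddCommGroup (Induced A N M B Y) :=
  (Induced.equivProd A N M B Y).addCommGroup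

@[simp] theorem Induced.zero_left : (0 : Induced A N M B Y).left = 0 := rfl
@[simp] theorem Induced.zero_right : (0 : Induced A N M B Y).right = 0 := rfl
@[simp] theorem Induced.add_left (x y : Induced A N M B Y) : (x + y).left = x.left + y.left := rfl
@[simp] theorem Induced.add_right (x y : Induced A N M B Y) :
    (x + y).right = x.right + y.right := rfl

/-- This is Y ⊗_B (M, B) for the second row (M, B) of Λ; the entry in `N` acts by zero because the
product M × N → B vanishes. -/
noncomputable instance : SMul (MoritaRing A N M B)ᵐᵒᵖ (Induced A N M B Y) :=
  ⟨fun l x => ⟨MulOpposite.op l.unop.a • x.left + BalancedTensor.tmul B A l.unop.m x.right,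
    MulOpposite.op l.unop.b • x.right⟩⟩

@[simp] theorem Induced.smul_left (l : (MoritaRing A N M B)ᵐᵒᵖ) (x : Induced A N M B Y) :
    (l • x).left = MulOpposite.op l.unop.a • x.left +
      BalancedTensor.tmul B A l.unop.m x.right := rfl

@[simp] theorem Induced.smul_right (l : (MoritaRing A N M B)ᵐᵒᵖ) (x : Induced A N M B Y) :
    (l • x).right = MulOpposite.op l.unop.b • x.right := rfl

noncomputable instance : Module (MoritaRing A N M B)ᵐᵒᵖ (Induced A N M B Y) where
  one_smul x := Induced.ext (by simp) (by simp)
  mul_smul l l' x := by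
    refine Induced.ext ?_ ?_
    · simp only [Induced.smul_left, Induced.smul_right, MulOpposite.unop_mul, mul_a, mul_m,
        MulOpposite.op_mul, mul_smul, smul_add, _root_.map_add, AddMonoidHom.add_apply,
        BalancedTensor.op_smul_tmul, BalancedTensor.smul_tmul, add_assoc]
    · simp [mul_smul]
  smul_zero l := Induced.ext (by simp) (by simp)
  smul_add l x y := Induced.ext (by simp [add_add_add_comm]) (by simp)
  add_smul l l' x := Induced.ext (by simp [add_smul, add_add_add_comm]) (by simp [add_smul])
  zero_smul x := Induced.ext (by simp) (by simp)

variable (A N) in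
/-- The map `(Y ⊗_B M, Y) → (Y' ⊗_B M, Y')` induced by `Y → Y'`. -/
noncomputable def Induced.map (f : Y →ₗ[Bᵐᵒᵖ] Y') :
    Induced A N M B Y →ₗ[(MoritaRing A N M B)ᵐᵒᵖ] Induced A N M B Y' where
  toFun x := ⟨BalancedTensor.map B A M f x.left, f x.right⟩
  map_add' x y := Induced.ext (_root_.map_add _ x.left y.left) (_root_.map_add f x.right y.right)
  map_smul' l x := Induced.ext (by simp [BalancedTensor.map_tmul]) (by simp)

variable (A N M B) in
/-- The functor `Y ↦ (Y ⊗_B M, Y)`. -/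
noncomputable def induced : ModuleCat.{u} Bᵐᵒᵖ ⥤ ModuleCat.{u} (MoritaRing A N M B)ᵐᵒᵖ where
  obj Y := ModuleCat.of _ (Induced A N M B Y)
  map f := ModuleCat.ofHom (Induced.map A N f.hom)
  map_id Y := ModuleCat.hom_ext <| LinearMap.ext fun x =>
    Induced.ext (LinearMap.congr_fun (BalancedTensor.map_id B A M Y) x.left) rfl
  map_comp f g := ModuleCat.hom_ext <| LinearMap.ext fun x =>
    Induced.ext (LinearMap.congr_fun (BalancedTensor.map_comp B A M g.hom f.hom) x.left) rfl

instance : (induced A N M B).Additive where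
  map_add {_ _ f g} := ModuleCat.hom_ext <| LinearMap.ext fun x =>
    Induced.ext (LinearMap.congr_fun (BalancedTensor.map_add B A M f.hom g.hom) x.left) rfl

theorem preservesExtensions_induced [Module.Projective B M] :
    PreservesExtensions (induced A N M B) := by
  rintro Y' Y Y'' ⟨f, g, hf, hfg, hg⟩
  refine ⟨Induced.map A N f, Induced.map A N g, ?_, ?_, ?_⟩
  · intro x y hxy
    exact Induced.ext (BalancedTensor.map_injective hf (congrArg Induced.left hxy))
      (hf (congrArg Induced.right hxy))
  · intro x
    have h1 := BalancedTensor.map_exact (A := B) (B := A) (N := M) hfg hg x.left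
    have h2 := hfg x.right
    constructor
    · intro h
      obtain ⟨t, ht⟩ := h1.1 (congrArg Induced.left h)
      obtain ⟨y, hy⟩ := h2.1 (congrArg Induced.right h)
      exact ⟨⟨t, y⟩, Induced.ext ht hy⟩
    · rintro ⟨⟨t, y⟩, rfl⟩
      exact Induced.ext (h1.2 ⟨t, rfl⟩) (h2.2 ⟨y, rfl⟩)
  · intro x
    obtain ⟨t, ht⟩ := BalancedTensor.map_surjective (A := B) (B := A) (N := M) hg x.left
    obtain ⟨y, hy⟩ := hg x.right
    exact ⟨⟨t, y⟩, Induced.ext ht hy⟩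

/-- `(Y ⊗_B M, Y)` is generated by `Y`. -/
theorem Induced.eq_top_of_forall_mem
    (W : Submodule (MoritaRing A N M B)ᵐᵒᵖ (Induced A N M B Y)) (h : ∀ y : Y, ⟨0, y⟩ ∈ W) :
    W = ⊤ := by
  have h' (t : BalancedTensor B A M Y) : ⟨t, 0⟩ ∈ W := by
    induction t using BalancedTensor.induction_on with
    | zero => exact W.zero_mem
    | tmul m y =>
      convert W.smul_mem (MulOpposite.op (⟨0, 0, m, 0⟩ : MoritaRing A N M B)) (h y) using 1
      ext <;> simp
    | add s t hs ht =>
      convert W.add_mem hs ht using 1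
      ext <;> simp
  rw [Submodule.eq_top_iff']
  rintro ⟨t, y⟩
  convert W.add_mem (h' t) (h y) using 1
  ext <;> simp

instance [Module.Finite Bᵐᵒᵖ Y] : Module.Finite (MoritaRing A N M B)ᵐᵒᵖ (Induced A N M B Y) := by
  classical
  obtain ⟨s, hs⟩ := Module.Finite.fg_top (R := Bᵐᵒᵖ) (M := Y)
  refine ⟨⟨s.image fun y => ⟨0, y⟩, Induced.eq_top_of_forall_mem _ fun y => ?_⟩⟩
  have hy : y ∈ Submodule.span Bᵐᵒᵖ (s : Set Y) := hs ▸ Submodule.mem_top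
  induction hy using Submodule.span_induction with
  | mem y hy => exact Submodule.subset_span (by simpa using hy)
  | zero => exact Submodule.zero_mem _
  | add y z _ _ hy hz =>
    convert Submodule.add_mem _ hy hz using 1
    ext <;> simp
  | smul b y _ hy =>
    convert Submodule.smul_mem _ (MulOpposite.op (⟨0, 0, 0, b.unop⟩ : MoritaRing A N M B)) hy using 1
    ext <;> simp

/-- By B ⊗_B M ≅ M this is the second row (M, B) of Λ. It is a retract of Λ: `p` sends 1 to the
generator (0, 1), and `s` places (t, b) in the second row. -/
theorem projective_induced_self :
    Module.Projective (MoritaRing A N M B)ᵐᵒᵖ (Induced A N M B Bᵐᵒᵖ) := by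
  let μ : BalancedTensor B A M Bᵐᵒᵖ →+ M := BalancedTensor.lift
    (AddMonoidHom.mk' (fun m => AddMonoidHom.mk' (fun b => b.unop • m)
      fun b b' => by simp [add_smul]) fun m m' => by ext; simp) fun b m b' => by simp [mul_smul]
  have hμ (m : M) (b : Bᵐᵒᵖ) : μ (BalancedTensor.tmul B A m b) = b.unop • m := rfl
  have hμs (a : Aᵐᵒᵖ) (t) : μ (a • t) = a • μ t := by
    induction t using BalancedTensor.induction_on with
    | zero => simp
    | tmul m b => rw [BalancedTensor.op_smul_tmul, hμ, hμ, smul_comm]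
    | add s t hs ht => rw [smul_add, _root_.map_add, hs, ht, _root_.map_add, smul_add]
  let s : Induced A N M B Bᵐᵒᵖ →ₗ[(MoritaRing A N M B)ᵐᵒᵖ] (MoritaRing A N M B)ᵐᵒᵖ :=
    { toFun := fun x => MulOpposite.op ⟨0, 0, μ x.left, x.right.unop⟩
      map_add' := fun x y => by
        apply MulOpposite.unop_injective
        ext <;> simp
      map_smul' := fun l x => by
        apply MulOpposite.unop_injective
        ext <;> simp [hμ, hμs] }
  let p : (MoritaRing A N M B)ᵐᵒᵖ →ₗ[(MoritaRing A N M B)ᵐᵒᵖ] Induced A N M B Bᵐᵒᵖ :=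
    LinearMap.toSpanSingleton _ _ ⟨0, 1⟩
  refine Module.Projective.of_split s p (LinearMap.ext fun x => ?_)
  have hx (t : BalancedTensor B A M Bᵐᵒᵖ) : BalancedTensor.tmul B A (μ t) 1 = t := by
    induction t using BalancedTensor.induction_on with
    | zero => simp
    | tmul m b =>
      rw [hμ, BalancedTensor.smul_tmul]
      simp
    | add s t hs ht => rw [_root_.map_add, _root_.map_add, AddMonoidHom.add_apply, hs, ht]
  ext <;> simp [s, p, hx]

theorem hasProjectiveDimensionLE_induced [Module.Projective B M] [IsNoetherianRing Bᵐᵒᵖ] {d : ℕ}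
    {Y : ModuleCat.{u} Bᵐᵒᵖ} (hY : Module.Finite Bᵐᵒᵖ Y) (hd : HasProjectiveDimensionLE Y d) :
    HasProjectiveDimensionLE ((induced A N M B).obj Y) d :=
  preservesExtensions_induced.hasProjectiveDimensionLE_obj (c := 0)
    (hasProjectiveDimensionLE_zero_iff.2 projective_induced_self) hY hd

theorem _root_.IsSyzygy.induced [Module.Projective B M] [IsNoetherianRing Bᵐᵒᵖ] {n : ℕ}
    {Y K : ModuleCat.{u} Bᵐᵒᵖ} (h : IsSyzygy Bᵐᵒᵖ n Y K) :
    IsSyzygy (MoritaRing A N M B)ᵐᵒᵖ n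
      ((induced A N M B).obj Y) ((induced A N M B).obj K) :=
  IsSyzygy.obj preservesExtensions_induced (fun P h₁ h₂ =>
    ⟨inferInstanceAs (Module.Finite _ (Induced A N M B P)), hasProjectiveDimensionLE_zero_iff.1
      (hasProjectiveDimensionLE_induced h₁ (hasProjectiveDimensionLE_zero_iff.2 h₂))⟩) h

end Induced

/-! ### The functor `(X, Y) ↦ Y` -/

section Corner

variable {Z : Type u} [AddCommGroup Z] [Module (MoritaRing A N M B)ᵐᵒᵖ Z]

variable (A N M B) in
/-- The element `(0 0; 0 b)` of `Λ`. -/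
def inclB (b : B) : MoritaRing A N M B := ⟨0, 0, 0, b⟩

variable (A N M B) in
/-- The element `(a 0; 0 0)` of `Λ`. -/
def inclA (a : A) : MoritaRing A N M B := ⟨a, 0, 0, 0⟩

theorem inclB_mul (b b' : B) : inclB A N M B (b * b') = inclB A N M B b * inclB A N M B b' := by
  ext <;> simp [inclB]

theorem inclB_add (b b' : B) : inclB A N M B (b + b') = inclB A N M B b + inclB A N M B b' := by
  ext <;> simp [inclB]

theorem inclA_add_inclB : inclA A N M B 1 + inclB A N M B 1 = 1 := by
  ext <;> simp [inclA, inclB]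

variable (A N M B) in
/-- The component `Y` of a right `Λ`-module `(X, Y)`. -/
def Corner (Z : Type u) [AddCommGroup Z] [Module (MoritaRing A N M B)ᵐᵒᵖ Z] : AddSubgroup Z where
  carrier := {z | MulOpposite.op (inclB A N M B 1) • z = z}
  add_mem' {x y} hx hy := (smul_add _ x y).trans (congrArg₂ _ hx hy)
  zero_mem' := smul_zero _
  neg_mem' {x} hx := (smul_neg _ x).trans (congrArg _ hx)

theorem mem_corner_iff {z : Z} :
    z ∈ Corner A N M B Z ↔ MulOpposite.op (inclB A N M B 1) • z = z := Iff.rfl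

theorem inclB_smul_mem_corner (b : B) (z : Z) :
    MulOpposite.op (inclB A N M B b) • z ∈ Corner A N M B Z := by
  rw [mem_corner_iff, ← mul_smul, ← MulOpposite.op_mul, ← inclB_mul, mul_one]

noncomputable instance : Module Bᵐᵒᵖ (Corner A N M B Z) where
  smul b z := ⟨MulOpposite.op (inclB A N M B b.unop) • z.1, inclB_smul_mem_corner _ _⟩
  one_smul z := Subtype.ext z.2
  mul_smul b b' z := Subtype.ext <| by
    change MulOpposite.op (inclB A N M B (b'.unop * b.unop)) • z.1 = _
    rw [inclB_mul, MulOpposite.op_mul, mul_smul]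
    rfl
  smul_zero b := Subtype.ext (smul_zero _)
  smul_add b y z := Subtype.ext (smul_add _ _ _)
  add_smul b b' z := Subtype.ext <| by
    change MulOpposite.op (inclB A N M B (b.unop + b'.unop)) • z.1 = _
    rw [inclB_add, MulOpposite.op_add, add_smul]
    rfl
  zero_smul z := Subtype.ext (zero_smul _ z.1)

theorem corner_smul_val (b : Bᵐᵒᵖ) (z : Corner A N M B Z) :
    (b • z).1 = MulOpposite.op (inclB A N M B b.unop) • z.1 := rfl

variable (A N M B) in
/-- The functor sending a right `Λ`-module `(X, Y)` to the right `B`-module `Y`. -/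
noncomputable def corner : ModuleCat.{u} (MoritaRing A N M B)ᵐᵒᵖ ⥤ ModuleCat.{u} Bᵐᵒᵖ where
  obj Z := ModuleCat.of Bᵐᵒᵖ (Corner A N M B Z)
  map {Z Z'} f := ModuleCat.ofHom
    { toFun := fun z => ⟨f.hom z.1, by rw [mem_corner_iff, ← map_smul, mem_corner_iff.1 z.2]⟩
      map_add' := fun y z => Subtype.ext (_root_.map_add f.hom y.1 z.1)
      map_smul' := fun b z => Subtype.ext (map_smul f.hom _ z.1) }
  map_id Z := rfl
  map_comp f g := rfl

instance : (corner A N M B).Additive where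
  map_add := rfl

theorem preservesExtensions_corner : PreservesExtensions (corner A N M B) := by
  rintro Z' Z Z'' ⟨f, g, hf, hfg, hg⟩
  refine ⟨((corner A N M B).map (ModuleCat.ofHom f)).hom,
    ((corner A N M B).map (ModuleCat.ofHom g)).hom, ?_, ?_, ?_⟩
  · exact fun x y hxy => Subtype.ext (hf (congrArg Subtype.val hxy))
  · rintro ⟨z, hz⟩
    constructor
    · intro h
      obtain ⟨x, rfl⟩ := (hfg z).1 (congrArg Subtype.val h)
      exact ⟨⟨x, hf ((map_smul f _ x).trans hz)⟩, rfl⟩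
    · rintro ⟨x, hx⟩
      obtain rfl : f x.1 = z := congrArg Subtype.val hx
      exact Subtype.ext (hfg.apply_apply_eq_zero x.1)
  · rintro ⟨z, hz⟩
    obtain ⟨x, rfl⟩ := hg z
    exact ⟨⟨_, inclB_smul_mem_corner 1 x⟩, Subtype.ext ((map_smul g _ x).trans hz)⟩

/-- A set of elements of `Y` which generates a right `Λ`-module containing `Y` generates `Y`. -/
theorem Corner.span_eq_top (s : Set (Corner A N M B Z))
    (h : ∀ z : Corner A N M B Z,
      z.1 ∈ Submodule.span (MoritaRing A N M B)ᵐᵒᵖ (Subtype.val '' s)) :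
    Submodule.span Bᵐᵒᵖ s = ⊤ := by
  -- For the idempotent e = (0 0; 0 1) and y = ye one has yle = y(ele), and ele is the lower right
  -- entry of l. Quantifying over l takes care of the scalar step.
  have key (z : Z) (hz : z ∈ Submodule.span (MoritaRing A N M B)ᵐᵒᵖ (Subtype.val '' s)) :
      ∀ l : (MoritaRing A N M B)ᵐᵒᵖ,
        (⟨MulOpposite.op (inclB A N M B 1) • (l • z), inclB_smul_mem_corner 1 _⟩ :
          Corner A N M B Z) ∈ Submodule.span Bᵐᵒᵖ s := by
    induction hz using Submodule.span_induction with
    | mem z hz =>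
      obtain ⟨y, hy, rfl⟩ := hz
      intro l
      convert Submodule.smul_mem _ (MulOpposite.op l.unop.b) (Submodule.subset_span hy) using 1
      apply Subtype.ext
      rw [corner_smul_val]
      conv_lhs => rw [← mem_corner_iff.1 y.2]
      simp only [← mul_smul]
      conv_rhs => rw [← mem_corner_iff.1 y.2, ← mul_smul]
      congr 1
      apply MulOpposite.unop_injective
      ext <;> simp [inclB]
    | zero =>
      intro l
      convert Submodule.zero_mem _ using 1
      exact Subtype.ext (by simp)
    | add y z _ _ hy hz =>
      intro l
      convert Submodule.add_mem _ (hy l) (hz l) using 1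
      exact Subtype.ext (by simp)
    | smul l' z _ hz =>
      intro l
      simp only [← mul_smul l l']
      exact hz _
  rw [Submodule.eq_top_iff']
  intro z
  convert key z.1 (h z) 1 using 1
  exact Subtype.ext (((congrArg _ (one_smul _ z.1)).trans z.2).symm)

/-- The Λ-submodule generated by `Y` is finitely generated, and its finitely many generators can be
chosen inside `Y`; they then generate `Y` over `B`. -/
instance [IsNoetherianRing (MoritaRing A N M B)ᵐᵒᵖ] [Module.Finite (MoritaRing A N M B)ᵐᵒᵖ Z] :
    Module.Finite Bᵐᵒᵖ (Corner A N M B Z) := by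
  classical
  obtain ⟨s, hs, h⟩ := (Submodule.fg_span_iff_fg_span_finset_subset _).1
    (IsNoetherian.noetherian (Submodule.span (MoritaRing A N M B)ᵐᵒᵖ (Corner A N M B Z : Set Z)))
  lift s to Finset (Corner A N M B Z) using hs
  refine ⟨⟨s, Corner.span_eq_top _ fun z => ?_⟩⟩
  have := Submodule.subset_span (R := (MoritaRing A N M B)ᵐᵒᵖ) z.2
  rw [h] at this
  simpa using this

theorem Induced.left_eq_zero_of_mem_corner {Y : Type u} [AddCommGroup Y] [Module Bᵐᵒᵖ Y]
    {x : Induced A N M B Y} (hx : x ∈ Corner A N M B (Induced A N M B Y)) : x.left = 0 := by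
  simpa [inclB] using (congrArg Induced.left (mem_corner_iff.1 hx)).symm

/-- The component `Y` of `(Y ⊗_B M, Y)`. -/
noncomputable def cornerInduced (Y : ModuleCat.{u} Bᵐᵒᵖ) :
    (corner A N M B).obj ((induced A N M B).obj Y) ≃ₗ[Bᵐᵒᵖ] Y where
  toFun z := z.1.right
  map_add' _ _ := rfl
  map_smul' _ _ := rfl
  invFun y := ⟨(⟨0, y⟩ : Induced A N M B Y), by
    change MulOpposite.op (inclB A N M B 1) • (⟨0, y⟩ : Induced A N M B Y) = ⟨0, y⟩
    ext <;> simp [inclB]⟩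
  left_inv z := Subtype.ext (Induced.ext (Induced.left_eq_zero_of_mem_corner z.2).symm rfl)
  right_inv y := rfl

end Corner

/-- The Artin algebra hypothesis enters the theorem only through this property. -/
theorem isNoetherianRing_op_of_isArtinAlgebra {R : Type u} [Ring R] (h : IsArtinAlgebra R) :
    IsNoetherianRing Rᵐᵒᵖ := by
  obtain ⟨k, _, _, hk, hR⟩ := h
  have : Module.Finite k Rᵐᵒᵖ := Module.Finite.equiv (MulOpposite.opLinearEquiv k)
  exact IsNoetherianRing.of_finite k Rᵐᵒᵖ

theorem toA_surjective : Function.Surjective (RingHom.op (toA : MoritaRing A N M B →+* A)) :=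
  fun a => ⟨MulOpposite.op (inclA A N M B a.unop), rfl⟩

theorem toB_surjective : Function.Surjective (RingHom.op (toB : MoritaRing A N M B →+* B)) :=
  fun b => ⟨MulOpposite.op (inclB A N M B b.unop), rfl⟩

/-! ### The counit `(Y ⊗_B M, Y) → (X, Y)` -/

section Counit

variable {Z : Type u} [AddCommGroup Z] [Module (MoritaRing A N M B)ᵐᵒᵖ Z]

variable (A N M B Z) in
/-- The multiplication map `Y ⊗_B M → X` of a right `Λ`-module `(X, Y)`. -/
noncomputable def cornerMul : BalancedTensor B A M (Corner A N M B Z) →+ Z :=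
  BalancedTensor.lift (AddMonoidHom.mk' (fun m => AddMonoidHom.mk'
    (fun y => MulOpposite.op (⟨0, 0, m, 0⟩ : MoritaRing A N M B) • y.1)
    fun y y' => smul_add _ y.1 y'.1) fun m m' => by
      ext y
      change MulOpposite.op (⟨0, 0, m + m', 0⟩ : MoritaRing A N M B) • y.1 =
        MulOpposite.op (⟨0, 0, m, 0⟩ : MoritaRing A N M B) • y.1 +
          MulOpposite.op (⟨0, 0, m', 0⟩ : MoritaRing A N M B) • y.1
      rw [← add_smul, ← MulOpposite.op_add]
      congr 2
      ext <;> simp) fun b m y => by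
      change MulOpposite.op (⟨0, 0, b • m, 0⟩ : MoritaRing A N M B) • y.1 =
        MulOpposite.op (⟨0, 0, m, 0⟩ : MoritaRing A N M B) • (MulOpposite.op b • y).1
      rw [corner_smul_val, ← mul_smul, ← MulOpposite.op_mul]
      congr 2
      ext <;> simp [inclB]

theorem cornerMul_tmul (m : M) (y : Corner A N M B Z) :
    cornerMul A N M B Z (BalancedTensor.tmul B A m y) =
      MulOpposite.op (⟨0, 0, m, 0⟩ : MoritaRing A N M B) • y.1 := rfl

theorem smul_cornerMul (l : (MoritaRing A N M B)ᵐᵒᵖ)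
    (t : BalancedTensor B A M (Corner A N M B Z)) :
    l • cornerMul A N M B Z t = cornerMul A N M B Z (MulOpposite.op l.unop.a • t) := by
  induction t using BalancedTensor.induction_on with
  | zero => simp
  | tmul m y =>
    rw [BalancedTensor.op_smul_tmul, cornerMul_tmul, cornerMul_tmul, ← mul_smul]
    congr 1
    apply MulOpposite.unop_injective
    ext <;> simp
  | add s t hs ht => simp only [_root_.map_add, smul_add, hs, ht]

theorem smul_corner_val (l : (MoritaRing A N M B)ᵐᵒᵖ) (y : Corner A N M B Z) :
    l • y.1 = cornerMul A N M B Z (BalancedTensor.tmul B A l.unop.m y) +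
      (MulOpposite.op l.unop.b • y).1 := by
  rw [cornerMul_tmul, corner_smul_val, ← add_smul]
  conv_lhs => rw [← mem_corner_iff.1 y.2, ← mul_smul]
  congr 1
  apply MulOpposite.unop_injective
  ext <;> simp [inclB]

variable (A N M B Z) in
/-- The counit `(Y ⊗_B M, Y) → (X, Y)`. -/
noncomputable def counit :
    Induced A N M B (Corner A N M B Z) →ₗ[(MoritaRing A N M B)ᵐᵒᵖ] Z where
  toFun x := cornerMul A N M B Z x.left + x.right.1
  map_add' x y := by simp [add_add_add_comm]
  map_smul' l x := by
    simp only [RingHom.id_apply, smul_add, smul_cornerMul, smul_corner_val, Induced.smul_left,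
      Induced.smul_right, _root_.map_add, add_assoc]

theorem inclB_smul_cornerMul (t : BalancedTensor B A M (Corner A N M B Z)) :
    MulOpposite.op (inclB A N M B 1) • cornerMul A N M B Z t = 0 := by
  rw [smul_cornerMul]
  simp [inclB]

/-- The counit is the identity on second components, so kernel and cokernel have zero second
component. -/
theorem inclB_smul_ker_counit (x : LinearMap.ker (counit A N M B Z)) :
    MulOpposite.op (inclB A N M B 1) • x = 0 := by
  obtain ⟨⟨t, y⟩, hx⟩ := x
  have h : cornerMul A N M B Z t + y.1 = 0 := hx
  have h' := congrArg (MulOpposite.op (inclB A N M B 1) • ·) h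
  simp only [smul_add, inclB_smul_cornerMul, smul_zero, zero_add, mem_corner_iff.1 y.2] at h'
  obtain rfl : y = 0 := Subtype.ext h'
  refine Subtype.ext (Induced.ext ?_ ?_)
  · simp [inclB]
  · simp

theorem inclB_smul_coker_counit (z : Z ⧸ LinearMap.range (counit A N M B Z)) :
    MulOpposite.op (inclB A N M B 1) • z = 0 := by
  obtain ⟨z, rfl⟩ := Submodule.Quotient.mk_surjective _ z
  rw [← Submodule.Quotient.mk_smul, Submodule.Quotient.mk_eq_zero]
  refine ⟨⟨0, ⟨_, inclB_smul_mem_corner 1 z⟩⟩, ?_⟩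
  change cornerMul A N M B Z 0 + _ = _
  rw [map_zero, zero_add]

end Counit

/-! ### Modules concentrated in the first component. -/

/-- The right `Λ`-modules `(X, 0)` have projective dimension at most `d`. -/
def ZeroAProjectiveDimensionLE (A N M B : Type u) [Ring A] [Ring B]
    [AddCommGroup N] [Module A N] [Module Bᵐᵒᵖ N] [SMulCommClass A Bᵐᵒᵖ N]
    [AddCommGroup M] [Module B M] [Module Aᵐᵒᵖ M] [SMulCommClass B Aᵐᵒᵖ M] (d : ℕ) : Prop :=
  ∀ X : ModuleCat.{u} Aᵐᵒᵖ, Module.Finite Aᵐᵒᵖ X →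
    HasProjectiveDimensionLE ((zeroA A N M B).obj X) d

/-- A finitely generated right `Λ`-module whose second component vanishes is of the form
`(X, 0)`. -/
theorem ZeroAProjectiveDimensionLE.of_inclB_smul {d : ℕ}
    (hd : ZeroAProjectiveDimensionLE A N M B d) (W : ModuleCat.{u} (MoritaRing A N M B)ᵐᵒᵖ)
    [Module.Finite (MoritaRing A N M B)ᵐᵒᵖ W]
    (hW : ∀ w : W, MulOpposite.op (inclB A N M B 1) • w = 0) : HasProjectiveDimensionLE W d := by
  have h1 (w : W) : MulOpposite.op (inclA A N M B 1) • w = w := by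
    have := congrArg (fun l => MulOpposite.op l • w)
      (inclA_add_inclB (A := A) (N := N) (M := M) (B := B))
    simpa [add_smul, hW] using this
  have h2 (l : (MoritaRing A N M B)ᵐᵒᵖ) (w : W) :
      MulOpposite.op (inclA A N M B l.unop.a) • w = l • w := by
    have h3 : MulOpposite.op (⟨0, l.unop.n, 0, 0⟩ : MoritaRing A N M B) • w = 0 := by
      rw [← hW (MulOpposite.op (⟨0, l.unop.n, 0, 0⟩ : MoritaRing A N M B) • w), ← mul_smul]
      congr 1
      apply MulOpposite.unop_injective
      ext <;> simp [inclB]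
    conv_rhs => rw [← h1 w, ← mul_smul]
    rw [← add_zero (MulOpposite.op (inclA A N M B l.unop.a) • w), ← h3, ← add_smul]
    congr 1
    apply MulOpposite.unop_injective
    ext <;> simp [inclA]
  let _ : Module Aᵐᵒᵖ W :=
    { smul := fun a w => MulOpposite.op (inclA A N M B a.unop) • w
      one_smul := h1
      mul_smul := fun a a' w => by
        change MulOpposite.op (inclA A N M B (a'.unop * a.unop)) • w =
          MulOpposite.op (inclA A N M B a.unop) • MulOpposite.op (inclA A N M B a'.unop) • w
        rw [← mul_smul, ← MulOpposite.op_mul]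
        congr 2
        ext <;> simp [inclA]
      smul_zero := fun a => smul_zero _
      smul_add := fun a w w' => smul_add _ w w'
      add_smul := fun a a' w => by
        change MulOpposite.op (inclA A N M B (a.unop + a'.unop)) • w =
          MulOpposite.op (inclA A N M B a.unop) • w + MulOpposite.op (inclA A N M B a'.unop) • w
        rw [← add_smul, ← MulOpposite.op_add]
        congr 2
        ext <;> simp [inclA]
      zero_smul := fun w => by
        rw [← zero_smul (MoritaRing A N M B)ᵐᵒᵖ w]
        rfl }
  let i : W →ₛₗ[RingHom.op (toA : MoritaRing A N M B →+* A)] W :=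
    { toFun := id
      map_add' := fun _ _ => rfl
      map_smul' := fun l w => (h2 l w).symm }
  have : RingHomSurjective (RingHom.op (toA : MoritaRing A N M B →+* A)) := ⟨toA_surjective⟩
  have hf : Module.Finite Aᵐᵒᵖ W := Module.Finite.of_surjective i Function.surjective_id
  let e : (zeroA A N M B).obj (ModuleCat.of Aᵐᵒᵖ W) ≃ₗ[(MoritaRing A N M B)ᵐᵒᵖ] W :=
    { toFun := id
      invFun := id
      left_inv := fun _ => rfl
      right_inv := fun _ => rfl
      map_add' := fun _ _ => rfl
      map_smul' := fun l w => h2 l w }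
  exact hasProjectiveDimensionLE_congr (hd (ModuleCat.of Aᵐᵒᵖ W) hf) e

/-! ### Comparison of the Igusa-Todorov distances -/

/-- An (n+k+1)-syzygy of `X` is an (n+k)-syzygy of a first syzygy of `X`, so the same `U` works. -/
theorem _root_.IsIgusaTodorovAlgebra.add {R : Type u} [Ring R] [IsNoetherianRing Rᵐᵒᵖ] {m n : ℕ}
    (h : IsIgusaTodorovAlgebra R m n) (k : ℕ) : IsIgusaTodorovAlgebra R m (n + k) := by
  induction k with
  | zero => exact h
  | succ k ih =>
    obtain ⟨U, hU, h⟩ := ih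
    refine ⟨U, hU, fun X K hX hK hs => ?_⟩
    obtain ⟨P, L, h₁, h₂, hE, hL⟩ := isSyzygy_succ_iff.1 hs
    exact h L K hE.finite_left hK hL

/-- The counit T → Z from T = (Y ⊗_B M, Y) is split into 0 → W → T → I → 0 and 0 → I → Z → C → 0.
The syzygies of T are resolved over B, and W and C have projective dimension at most d. -/
theorem isIgusaTodorovAlgebra_of_zeroA [IsNoetherianRing (MoritaRing A N M B)ᵐᵒᵖ]
    [Module.Projective B M] {d m n : ℕ} (hd : ZeroAProjectiveDimensionLE A N M B d)
    (h : IsIgusaTodorovAlgebra B m n) :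
    IsIgusaTodorovAlgebra (MoritaRing A N M B) (m + 1) (n + d) := by
  have : IsNoetherianRing Bᵐᵒᵖ := isNoetherianRing_of_surjective _ _ _ (toB_surjective
    (A := A) (N := N) (M := M) (B := B))
  obtain ⟨U, hU, h⟩ := h.add d
  let R := (MoritaRing A N M B)ᵐᵒᵖ
  -- The summand `R` puts all finitely generated projectives into `add V`.
  let V : ModuleCat.{u} R := ModuleCat.of R (Induced A N M B U × R)
  have hVR : InAdd R V (ModuleCat.of R R) :=
    ⟨ModuleCat.of R (Induced A N M B U), 1,
      ⟨(LinearEquiv.prodComm R R (Induced A N M B U)).trans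
        (LinearEquiv.funUnique (Fin 1) R (Induced A N M B U × R)).symm⟩⟩
  have hVU : InAdd R V ((induced A N M B).obj U) :=
    ⟨ModuleCat.of R R, 1, ⟨(LinearEquiv.funUnique (Fin 1) R (Induced A N M B U × R)).symm⟩⟩
  refine ⟨V, inferInstanceAs (Module.Finite R (Induced A N M B U × R)), fun Z K hZ hK hs => ?_⟩
  let Y : ModuleCat.{u} Bᵐᵒᵖ := ModuleCat.of Bᵐᵒᵖ (Corner A N M B Z)
  have hY : Module.Finite Bᵐᵒᵖ Y := inferInstanceAs (Module.Finite Bᵐᵒᵖ (Corner A N M B Z))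
  obtain ⟨KY, hKY⟩ := exists_isSyzygy (n + d) Y
  have hres : HasAddResolution R V m ((induced A N M B).obj KY) :=
    ((h Y KY hY hKY.finite hKY).obj preservesExtensions_induced).trans hVU
  let ε := counit A N M B Z
  let T : ModuleCat.{u} R := (induced A N M B).obj Y
  have hT : Module.Finite R T := inferInstanceAs (Module.Finite R (Induced A N M B Y))
  let W : ModuleCat.{u} R := ModuleCat.of R (LinearMap.ker ε)
  let I : ModuleCat.{u} R := ModuleCat.of R (LinearMap.range ε)
  let C : ModuleCat.{u} R := ModuleCat.of R (Z ⧸ LinearMap.range ε)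
  have e₁ : IsExtension R W T I :=
    (isExtension_ker ε.surjective_rangeRestrict).congr
      (LinearEquiv.ofEq _ _ ε.ker_rangeRestrict) (LinearEquiv.refl R _) (LinearEquiv.refl R _)
  have e₂ : IsExtension R I Z C := isExtension_quotient _
  have fW : Module.Finite R W := e₁.finite_left
  have fI : Module.Finite R I := e₁.finite_right
  have fC : Module.Finite R C := e₂.finite_right
  obtain ⟨KW, hKW⟩ := exists_isSyzygy (n + d) W
  obtain ⟨KI, hKI⟩ := exists_isSyzygy (n + d) I
  obtain ⟨KC, hKC⟩ := exists_isSyzygy (n + d) C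
  have := hKW.finite
  have := hKC.finite
  have := hKW.projective (hasProjectiveDimensionLE_mono
    (hd.of_inclB_smul W inclB_smul_ker_counit) (Nat.le_add_left d n))
  have := hKC.projective (hasProjectiveDimensionLE_mono
    (hd.of_inclB_smul C inclB_smul_coker_counit) (Nat.le_add_left d n))
  -- Passing from T to its quotient I costs one term; passing from I to Z costs nothing.
  exact e₂.hasAddResolution_middle hVR hKI hs hKC
    (e₁.hasAddResolution_right hVR hKW hKY.induced hKI hres)

/-- A syzygy over `B` is induced to Λ, resolved there, and the resolution is restricted to second
components; the two functors compose to the identity up to isomorphism. -/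
theorem isIgusaTodorovAlgebra_corner [IsNoetherianRing (MoritaRing A N M B)ᵐᵒᵖ]
    [Module.Projective B M] {m n : ℕ} (h : IsIgusaTodorovAlgebra (MoritaRing A N M B) m n) :
    IsIgusaTodorovAlgebra B m n := by
  have : IsNoetherianRing Bᵐᵒᵖ := isNoetherianRing_of_surjective _ _ _ (toB_surjective
    (A := A) (N := N) (M := M) (B := B))
  obtain ⟨U, hU, h⟩ := h
  refine ⟨(corner A N M B).obj U, inferInstanceAs (Module.Finite Bᵐᵒᵖ (Corner A N M B U)),
    fun Y K hY hK hs => ?_⟩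
  exact ((h ((induced A N M B).obj Y) ((induced A N M B).obj K)
    (inferInstanceAs (Module.Finite _ (Induced A N M B Y)))
    (inferInstanceAs (Module.Finite _ (Induced A N M B K))) hs.induced).obj
      preservesExtensions_corner).congr (cornerInduced K)

theorem igusaTodorovDistance_bounds [IsNoetherianRing (MoritaRing A N M B)ᵐᵒᵖ]
    [Module.Projective B M] {d : ℕ} (hd : ZeroAProjectiveDimensionLE A N M B d) :
    igusaTodorovDistance B ≤ igusaTodorovDistance (MoritaRing A N M B) ∧
      igusaTodorovDistance (MoritaRing A N M B) ≤ igusaTodorovDistance B + 2 := by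
  constructor
  · refine sInf_le_sInf ?_
    rintro _ ⟨m, rfl, n, h⟩
    exact ⟨m, rfl, n, isIgusaTodorovAlgebra_corner h⟩
  · rcases Set.eq_empty_or_nonempty
      {d : ℕ∞ | ∃ m : ℕ, d = m ∧ ∃ n : ℕ, IsIgusaTodorovAlgebra B m n} with he | hne
    · have : igusaTodorovDistance B = ⊤ := by rw [igusaTodorovDistance, he, sInf_empty]
      rw [this, top_add]
      exact le_top
    · obtain ⟨m, hm, n, h⟩ := csInf_mem hne
      have hm' : igusaTodorovDistance B = m := hm
      rw [hm']
      have hle : igusaTodorovDistance (MoritaRing A N M B) ≤ ((m + 1 : ℕ) : ℕ∞) :=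
        sInf_le ⟨m + 1, rfl, n + d, isIgusaTodorovAlgebra_of_zeroA hd h⟩
      refine hle.trans ?_
      exact_mod_cast Nat.add_le_add_left (by norm_num : 1 ≤ 2) m

theorem exists_hasProjectiveDimensionLE_of_rightGlobalDimension {R : Type u} [Ring R]
    (h : rightGlobalDimension R < ⊤) : ∃ d : ℕ, ∀ X : ModuleCat.{u} Rᵐᵒᵖ, Module.Finite Rᵐᵒᵖ X →
      HasProjectiveDimensionLE X d := by
  obtain ⟨d, hd⟩ : ∃ d : ℕ, rightGlobalDimension R ≤ d := by
    generalize rightGlobalDimension R = x at h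
    induction x with
    -- The value ⊥ is the global dimension of the zero ring.
    | bot => exact ⟨0, bot_le⟩
    | coe x =>
      lift x to ℕ using fun hx => by simp [hx] at h
      exact ⟨x, le_rfl⟩
  refine ⟨d, fun X hX => (projectiveDimension_le_iff X d).1 (le_trans ?_ hd)⟩
  exact le_iSup₂ (f := fun (X : ModuleCat.{u} Rᵐᵒᵖ) (_ : Module.Finite Rᵐᵒᵖ X) =>
    projectiveDimension X) X hX

/-- The regular right module, as a module over the opposite ring. -/
def opRegularEquiv (R : Type u) [Ring R] : R ≃ₗ[Rᵐᵒᵖ] Rᵐᵒᵖ :=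
  { MulOpposite.opAddEquiv with
    map_smul' := fun _ _ => rfl }

/-- Inflation along Λ → A is exact, so it raises projective dimension by at most that of (A, 0). -/
theorem ZeroAProjectiveDimensionLE.of_regular [IsNoetherianRing (MoritaRing A N M B)ᵐᵒᵖ]
    (h : rightGlobalDimension A < ⊤) {c : ℕ}
    (hc : HasProjectiveDimensionLE ((zeroA A N M B).obj (ModuleCat.of Aᵐᵒᵖ A)) c) :
    ∃ d, ZeroAProjectiveDimensionLE A N M B d := by
  have : IsNoetherianRing Aᵐᵒᵖ := isNoetherianRing_of_surjective _ _ _ (toA_surjective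
    (A := A) (N := N) (M := M) (B := B))
  obtain ⟨d, hd⟩ := exists_hasProjectiveDimensionLE_of_rightGlobalDimension h
  refine ⟨d + c, fun X hX => ?_⟩
  refine (preservesExtensions_restrictScalars _).hasProjectiveDimensionLE_obj ?_ hX (hd X hX)
  exact hasProjectiveDimensionLE_congr hc
    ((zeroA A N M B).mapIso (opRegularEquiv A).toModuleIso).toLinearEquiv

/-! ### Projective dimension of `(A, 0)` in terms of `(0, N)` -/

variable (A N M B) in
/-- The projective right `Λ`-module `(A, N)`, the first row of `Λ`. -/
def firstRow : Submodule (MoritaRing A N M B)ᵐᵒᵖ (MoritaRing A N M B)ᵐᵒᵖ where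
  carrier := {x | x.unop.m = 0 ∧ x.unop.b = 0}
  add_mem' {x y} hx hy := ⟨by simp [hx.1, hy.1], by simp [hx.2, hy.2]⟩
  zero_mem' := ⟨rfl, rfl⟩
  smul_mem' l x hx := ⟨by simp [hx.1, hx.2], by simp [hx.2]⟩

instance : Module.Projective (MoritaRing A N M B)ᵐᵒᵖ (firstRow A N M B) := by
  refine Module.Projective.of_split (firstRow A N M B).subtype
    { toFun := fun x => ⟨MulOpposite.op ⟨x.unop.a, x.unop.n, 0, 0⟩, rfl, rfl⟩
      map_add' := fun x y => Subtype.ext <| MulOpposite.unop_injective <| by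
        ext <;> simp
      map_smul' := fun l x => Subtype.ext <| MulOpposite.unop_injective <| by
        ext <;> simp } ?_
  ext x
  refine MulOpposite.unop_injective (MoritaRing.ext rfl rfl x.2.1.symm x.2.2.symm)

theorem isExtension_firstRow : IsExtension (MoritaRing A N M B)ᵐᵒᵖ
    ((zeroB A N M B).obj (ModuleCat.of Bᵐᵒᵖ N)) (firstRow A N M B)
    ((zeroA A N M B).obj (ModuleCat.of Aᵐᵒᵖ A)) := by
  let f : (zeroB A N M B).obj (ModuleCat.of Bᵐᵒᵖ N) →ₗ[(MoritaRing A N M B)ᵐᵒᵖ]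
      firstRow A N M B :=
    { toFun := fun n => ⟨MulOpposite.op ⟨0, n, 0, 0⟩, rfl, rfl⟩
      map_add' := fun n n' => Subtype.ext <| MulOpposite.unop_injective <| by
        ext <;> simp
        rfl
      map_smul' := fun l n => Subtype.ext <| MulOpposite.unop_injective <| by
        ext <;> simp
        rfl }
  let g : firstRow A N M B →ₗ[(MoritaRing A N M B)ᵐᵒᵖ]
      (zeroA A N M B).obj (ModuleCat.of Aᵐᵒᵖ A) :=
    { toFun := fun x => x.1.unop.a
      map_add' := fun x y => rfl
      map_smul' := fun l x => rfl }
  refine ⟨f, g, ?_, ?_, ?_⟩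
  · exact fun n n' h => congrArg (fun x : firstRow A N M B => x.1.unop.n) h
  · intro x
    constructor
    · intro h
      exact ⟨x.1.unop.n, Subtype.ext <| MulOpposite.unop_injective <|
        MoritaRing.ext (Eq.symm h) rfl x.2.1.symm x.2.2.symm⟩
    · rintro ⟨n, rfl⟩
      rfl
  · exact fun a => ⟨⟨MulOpposite.op ⟨a, 0, 0, 0⟩, rfl, rfl⟩, rfl⟩

theorem hasProjectiveDimensionLE_zeroA_regular {d : ℕ}
    (h : HasProjectiveDimensionLE ((zeroB A N M B).obj (ModuleCat.of Bᵐᵒᵖ N)) d) :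
    HasProjectiveDimensionLE ((zeroA A N M B).obj (ModuleCat.of Aᵐᵒᵖ A)) (d + 1) :=
  IsExtension.hasProjectiveDimensionLE_right
    (E := ModuleCat.of (MoritaRing A N M B)ᵐᵒᵖ (firstRow A N M B)) isExtension_firstRow d h
    (hasProjectiveDimensionLE_of_projective (ModuleCat.of _ (firstRow A N M B)) (d + 1))

/-! ### Tight resolutions -/

/-- The functor `Y ↦ (0, Y, 0, 0)` is full. -/
noncomputable def ofZeroBHom {Y Y' : ModuleCat.{u} Bᵐᵒᵖ}
    (f : (zeroB A N M B).obj Y →ₗ[(MoritaRing A N M B)ᵐᵒᵖ] (zeroB A N M B).obj Y') :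
    Y →ₗ[Bᵐᵒᵖ] Y' where
  toFun := f
  map_add' := f.map_add
  map_smul' b y := f.map_smul (MulOpposite.op (inclB A N M B b.unop)) y

/-- A Λ-linear section of a free cover of `Q` over `B` is already `B`-linear, by fullness. -/
theorem projective_of_zeroB {Q : ModuleCat.{u} Bᵐᵒᵖ}
    (h : Module.Projective (MoritaRing A N M B)ᵐᵒᵖ ((zeroB A N M B).obj Q)) :
    Module.Projective Bᵐᵒᵖ Q := by
  refine Module.Projective.of_lifting_property'' fun g hg => ?_
  obtain ⟨s, hs⟩ := Module.projective_lifting_property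
    ((zeroB A N M B).map (ModuleCat.ofHom (X := Q →₀ Bᵐᵒᵖ) (Y := Q) g)).hom LinearMap.id hg
  exact ⟨ofZeroBHom (A := A) (N := N) (M := M) (Y := Q) (Y' := ModuleCat.of Bᵐᵒᵖ (Q →₀ Bᵐᵒᵖ)) s,
    LinearMap.ext fun q => LinearMap.congr_fun hs q⟩

/-- Induction on `d`. The first term is (0, Q) with `Q` projective over `B` too, so the kernel `Y'`
of Q → Y has projective dimension one less over `B`, and the shifted sequence is a tight resolution
of (0, Y'). For d = 0 the map Q → Y splits over `B`, hence over Λ. -/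
theorem hasProjectiveDimensionLE_zeroB_of_tight {d : ℕ} {Y : ModuleCat.{u} Bᵐᵒᵖ}
    (hY : HasProjectiveDimensionLE Y d) (C : ℕ → ModuleCat.{u} (MoritaRing A N M B)ᵐᵒᵖ)
    (hC : ∀ i, IsBTightProjective (C i))
    (δ : ∀ i, C (i + 1) →ₗ[(MoritaRing A N M B)ᵐᵒᵖ] C i)
    (ε : C 0 →ₗ[(MoritaRing A N M B)ᵐᵒᵖ] (zeroB A N M B).obj Y) (hε : Function.Surjective ε)
    (h₀ : Function.Exact (δ 0) ε) (hδ : ∀ i, Function.Exact (δ (i + 1)) (δ i)) :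
    HasProjectiveDimensionLE ((zeroB A N M B).obj Y) d := by
  induction d generalizing Y C with
  | zero =>
    have := hasProjectiveDimensionLE_zero_iff.1 hY
    obtain ⟨-, hP, Q, ⟨φ⟩⟩ := hC 0
    let g : Q →ₗ[Bᵐᵒᵖ] Y := ofZeroBHom (ε ∘ₗ φ.toLinearEquiv.symm.toLinearMap)
    have hg : Function.Surjective g := hε.comp φ.toLinearEquiv.symm.surjective
    obtain ⟨s, hs⟩ := Module.projective_lifting_property g LinearMap.id hg
    rw [hasProjectiveDimensionLE_zero_iff]
    have hQ : Module.Projective _ ((zeroB A N M B).obj Q) :=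
      Module.Projective.of_equiv φ.toLinearEquiv
    exact Module.Projective.of_split ((zeroB A N M B).map (ModuleCat.ofHom s)).hom
      ((zeroB A N M B).map (ModuleCat.ofHom g)).hom (LinearMap.ext fun y => LinearMap.congr_fun hs y)
  | succ d ih =>
    obtain ⟨-, hP, Q, ⟨φ⟩⟩ := hC 0
    let g : Q →ₗ[Bᵐᵒᵖ] Y := ofZeroBHom (ε ∘ₗ φ.toLinearEquiv.symm.toLinearMap)
    have hg : Function.Surjective g := hε.comp φ.toLinearEquiv.symm.surjective
    have hQ : Module.Projective _ ((zeroB A N M B).obj Q) :=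
      Module.Projective.of_equiv φ.toLinearEquiv
    have hQ' : Module.Projective Bᵐᵒᵖ Q := projective_of_zeroB hQ
    let Y' : ModuleCat.{u} Bᵐᵒᵖ := ModuleCat.of Bᵐᵒᵖ (LinearMap.ker g)
    have hE : IsExtension Bᵐᵒᵖ Y' Q Y := isExtension_ker hg
    have hφ (x : C 0) : g (φ.toLinearEquiv x) = ε x :=
      congrArg ε (φ.toLinearEquiv.symm_apply_apply x)
    let ε' : C 1 →ₗ[(MoritaRing A N M B)ᵐᵒᵖ] (zeroB A N M B).obj Y' :=
      { toFun := fun x => ⟨φ.toLinearEquiv (δ 0 x), (hφ _).trans (h₀.apply_apply_eq_zero x)⟩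
        map_add' := fun x y => Subtype.ext <|
          (congrArg φ.toLinearEquiv ((δ 0).map_add x y)).trans (φ.toLinearEquiv.map_add _ _)
        map_smul' := fun l x => Subtype.ext <|
          (congrArg φ.toLinearEquiv ((δ 0).map_smul l x)).trans (φ.toLinearEquiv.map_smul _ _) }
    have := ih (hE.hasProjectiveDimensionLE_left d (hasProjectiveDimensionLE_of_projective Q d) hY)
      (fun i => C (i + 1)) (fun i => hC (i + 1)) (fun i => δ (i + 1)) ε' ?_ ?_
      (fun i => hδ (i + 1))
    · exact (preservesExtensions_restrictScalars _ _ _ _ hE).hasProjectiveDimensionLE_right d this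
        (hasProjectiveDimensionLE_of_projective _ _)
    · rintro ⟨q, hq⟩
      obtain ⟨x, rfl⟩ := φ.toLinearEquiv.surjective q
      obtain ⟨y, rfl⟩ := (h₀ x).1 ((hφ x).symm.trans hq)
      exact ⟨y, rfl⟩
    · intro x
      rw [← hδ 0 x]
      constructor
      · intro hx
        exact φ.toLinearEquiv.map_eq_zero_iff.1 (congrArg Subtype.val hx)
      · intro hx
        exact Subtype.ext ((congrArg φ.toLinearEquiv hx).trans φ.toLinearEquiv.map_zero)

theorem HasBTightResolution.hasProjectiveDimensionLE {d : ℕ} {Y : ModuleCat.{u} Bᵐᵒᵖ}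
    (h : HasBTightResolution A N M B Y) (hY : HasProjectiveDimensionLE Y d) :
    HasProjectiveDimensionLE ((zeroB A N M B).obj Y) d := by
  obtain ⟨R, hR⟩ := h
  refine hasProjectiveDimensionLE_zeroB_of_tight hY R.complex.X hR
    (fun i => (R.complex.d (i + 1) i).hom) (R.π.f 0).hom ?_ ?_ ?_
  · exact (ModuleCat.epi_iff_surjective (R.π.f 0)).1 inferInstance
  · exact (ShortComplex.ShortExact.moduleCat_exact_iff_function_exact _).1 R.exact₀
  · exact fun i => (ShortComplex.ShortExact.moduleCat_exact_iff_function_exact _).1 (R.exact_succ i)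

/-! ### Nilpotent bimodules -/

theorem isExtension_induced (Y : ModuleCat.{u} Bᵐᵒᵖ) : IsExtension (MoritaRing A N M B)ᵐᵒᵖ
    ((zeroA A N M B).obj ((tensorFunctor B A M).obj Y)) ((induced A N M B).obj Y)
    ((zeroB A N M B).obj Y) := by
  let f : (zeroA A N M B).obj ((tensorFunctor B A M).obj Y) →ₗ[(MoritaRing A N M B)ᵐᵒᵖ]
      Induced A N M B Y :=
    { toFun := fun t => ⟨t, 0⟩
      map_add' := fun s t => Induced.ext rfl (add_zero (0 : Y)).symm
      map_smul' := fun l t => Induced.ext (by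
        rw [RingHom.id_apply, Induced.smul_left]
        simp only [map_zero, add_zero]
        rfl) (by simp) }
  let g : Induced A N M B Y →ₗ[(MoritaRing A N M B)ᵐᵒᵖ] (zeroB A N M B).obj Y :=
    { toFun := fun x => x.right
      map_add' := fun x y => rfl
      map_smul' := fun l x => rfl }
  refine ⟨f, g, fun s t h => congrArg Induced.left h, fun x => ⟨fun h => ?_, ?_⟩,
    fun y => ⟨⟨0, y⟩, rfl⟩⟩
  · exact ⟨x.left, Induced.ext rfl (Eq.symm h)⟩
  · rintro ⟨t, rfl⟩
    rfl

theorem finite_zeroB_obj (Y : ModuleCat.{u} Bᵐᵒᵖ) [Module.Finite Bᵐᵒᵖ Y] :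
    Module.Finite (MoritaRing A N M B)ᵐᵒᵖ ((zeroB A N M B).obj Y) := by
  have : Module.Finite (MoritaRing A N M B)ᵐᵒᵖ ((induced A N M B).obj Y) :=
    inferInstanceAs (Module.Finite _ (Induced A N M B Y))
  exact (isExtension_induced Y).finite_right

/-- (Y ⊗_B M, 0) is a submodule of the finitely generated module (Y ⊗_B M, Y), and Λ acts on it
through `A`. -/
theorem finite_tensorFunctor_obj [IsNoetherianRing (MoritaRing A N M B)ᵐᵒᵖ]
    (Y : ModuleCat.{u} Bᵐᵒᵖ) [Module.Finite Bᵐᵒᵖ Y] :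
    Module.Finite Aᵐᵒᵖ ((tensorFunctor B A M).obj Y) := by
  have : Module.Finite (MoritaRing A N M B)ᵐᵒᵖ ((induced A N M B).obj Y) :=
    inferInstanceAs (Module.Finite _ (Induced A N M B Y))
  have := (isExtension_induced (A := A) (N := N) (M := M) (B := B) Y).finite_left
  let i : (zeroA A N M B).obj ((tensorFunctor B A M).obj Y)
      →ₛₗ[RingHom.op (toA : MoritaRing A N M B →+* A)] (tensorFunctor B A M).obj Y :=
    { toFun := id
      map_add' := fun _ _ => rfl
      map_smul' := fun l w => rfl }
  have : RingHomSurjective (RingHom.op (toA : MoritaRing A N M B →+* A)) := ⟨toA_surjective⟩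
  exact Module.Finite.of_surjective i Function.surjective_id

section Swap

variable [Module Aᵐᵒᵖ N] [SMulCommClass A Aᵐᵒᵖ N]

variable (A N) in
/-- The automorphism `(a n; m b) ↦ (b m; n a)` of the ring `(A N; N A)`. -/
def swap : MoritaRing A N N A ≃+* MoritaRing A N N A where
  toFun x := ⟨x.b, x.m, x.n, x.a⟩
  invFun x := ⟨x.b, x.m, x.n, x.a⟩
  left_inv _ := rfl
  right_inv _ := rfl
  map_add' _ _ := rfl
  map_mul' x y := by ext <;> simp [add_comm]

/-- Restriction along the automorphism `swap` is exact, preserves the regular module up to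
isomorphism, and turns (0, X) into (X, 0). -/
theorem hasProjectiveDimensionLE_zeroA_of_zeroB [IsNoetherianRing (MoritaRing A N N A)ᵐᵒᵖ] {d : ℕ}
    {X : ModuleCat.{u} Aᵐᵒᵖ} [Module.Finite Aᵐᵒᵖ X]
    (h : HasProjectiveDimensionLE ((zeroB A N N A).obj X) d) :
    HasProjectiveDimensionLE ((zeroA A N N A).obj X) d := by
  let e : (MoritaRing A N N A)ᵐᵒᵖ ≃+* (MoritaRing A N N A)ᵐᵒᵖ := RingEquiv.op (swap A N)
  refine (preservesExtensions_restrictScalars e.toRingHom).hasProjectiveDimensionLE_obj (c := 0)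
    ?_ (finite_zeroB_obj X) h
  rw [hasProjectiveDimensionLE_zero_iff]
  exact Module.Projective.of_equiv (ModuleCat.restrictScalarsIsoOfEquiv e).toLinearEquiv.symm

/-- Descending induction on the tensor power: `isExtension_induced` bounds (0, N^{⊗k}) in terms of
(N^{⊗(k+1)}, 0), which the swap relates to (0, N^{⊗(k+1)}). -/
theorem exists_hasProjectiveDimensionLE_zeroB_regular
    [IsNoetherianRing (MoritaRing A N N A)ᵐᵒᵖ] [Module.Projective A N]
    (h : rightGlobalDimension A < ⊤) (hN : IsNilpotentBimodule A N) :
    ∃ c, HasProjectiveDimensionLE ((zeroB A N N A).obj (ModuleCat.of Aᵐᵒᵖ A)) c := by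
  have : IsNoetherianRing Aᵐᵒᵖ := isNoetherianRing_of_surjective _ _ _ (toB_surjective
    (A := A) (N := N) (M := N) (B := A))
  obtain ⟨d, hd⟩ := exists_hasProjectiveDimensionLE_of_rightGlobalDimension h
  obtain ⟨n, hn⟩ := hN
  have hf (j : ℕ) : Module.Finite Aᵐᵒᵖ (tensorPower A N j) := by
    induction j with
    | zero => exact Module.Finite.equiv (opRegularEquiv A).symm
    | succ j ih => exact finite_tensorFunctor_obj (A := A) (N := N) (M := N) (B := A) _
  suffices ∀ j, ∃ c, HasProjectiveDimensionLE ((zeroB A N N A).obj (tensorPower A N (n - j))) c by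
    obtain ⟨c, hc⟩ := this n
    rw [Nat.sub_self] at hc
    exact ⟨c, hc⟩
  intro j
  induction j with
  | zero =>
    have : Subsingleton ((zeroB A N N A).obj (tensorPower A N (n - 0))) := hn
    exact ⟨0, hasProjectiveDimensionLE_of_subsingleton _ 0⟩
  | succ j ih =>
    obtain ⟨c, hc⟩ := ih
    rcases Nat.lt_or_ge j n with hj | hj
    · rw [show n - j = n - (j + 1) + 1 by omega] at hc
      have := hf (n - (j + 1) + 1)
      have hc' := hasProjectiveDimensionLE_zeroA_of_zeroB hc
      have hi := hasProjectiveDimensionLE_induced (A := A) (N := N) (M := N) (hf (n - (j + 1)))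
        (hd _ (hf (n - (j + 1))))
      -- The kernel has dimension at most `c`, the middle term at most `d`; their common bound `c +
      -- d` goes up by one for the cokernel.
      exact ⟨c + d + 1, (isExtension_induced (tensorPower A N (n - (j + 1)))
        ).hasProjectiveDimensionLE_right (c + d) (hasProjectiveDimensionLE_mono hc' (by omega))
          (hasProjectiveDimensionLE_mono hi (by omega))⟩
    -- Truncated subtraction makes the index stationary at 0.
    · rw [show n - (j + 1) = n - j by omega]
      exact ⟨c, hc⟩

end Swap

end MoritaRing

theorem mainTheorem7 :
    (∀ (A N M B : Type u) [Ring A] [Ring B]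
      [AddCommGroup N] [Module A N] [Module Bᵐᵒᵖ N] [SMulCommClass A Bᵐᵒᵖ N]
      [AddCommGroup M] [Module B M] [Module Aᵐᵒᵖ M] [SMulCommClass B Aᵐᵒᵖ M],
      IsArtinAlgebra (MoritaRing A N M B) →
      Module.Projective B M →
      rightGlobalDimension A < ⊤ →
      MoritaRing.HasBTightResolution A N M B (ModuleCat.of Bᵐᵒᵖ N) →
      projectiveDimension (ModuleCat.of Bᵐᵒᵖ N) < ⊤ →
      igusaTodorovDistance B ≤ igusaTodorovDistance (MoritaRing A N M B) ∧
        igusaTodorovDistance (MoritaRing A N M B) ≤ igusaTodorovDistance B + 2) ∧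
    (∀ (A N : Type u) [Ring A]
      [AddCommGroup N] [Module A N] [Module Aᵐᵒᵖ N] [SMulCommClass A Aᵐᵒᵖ N],
      IsArtinAlgebra (MoritaRing A N N A) →
      Module.Projective A N →
      rightGlobalDimension A < ⊤ →
      IsNilpotentBimodule A N →
      IsRightPerfect A N →
      igusaTodorovDistance A ≤ igusaTodorovDistance (MoritaRing A N N A) ∧
        igusaTodorovDistance (MoritaRing A N N A) ≤ igusaTodorovDistance A + 2) := by
  constructor
  · intro A N M B _ _ _ _ _ _ _ _ _ _ hΛ _ hA hN hN'
    have := MoritaRing.isNoetherianRing_op_of_isArtinAlgebra hΛ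
    obtain ⟨d, hd⟩ := (projectiveDimension_ne_top_iff _).1 hN'.ne
    obtain ⟨c, hc⟩ := MoritaRing.ZeroAProjectiveDimensionLE.of_regular hA
      (MoritaRing.hasProjectiveDimensionLE_zeroA_regular (hN.hasProjectiveDimensionLE hd))
    exact MoritaRing.igusaTodorovDistance_bounds hc
  · intro A N _ _ _ _ _ hΛ _ hA hN _
    have := MoritaRing.isNoetherianRing_op_of_isArtinAlgebra hΛ
    have : Module.Finite Aᵐᵒᵖ (ModuleCat.of Aᵐᵒᵖ A) :=
      have : Module.Finite Aᵐᵒᵖ A := Module.Finite.equiv (MoritaRing.opRegularEquiv A).symm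
      this
    obtain ⟨c, hc⟩ := MoritaRing.exists_hasProjectiveDimensionLE_zeroB_regular hA hN
    obtain ⟨d, hd⟩ := MoritaRing.ZeroAProjectiveDimensionLE.of_regular hA
      (MoritaRing.hasProjectiveDimensionLE_zeroA_of_zeroB hc)
    exact MoritaRing.igusaTodorovDistance_bounds hd
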